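/- Let $d\ge 0$. A real matrix $A$ indexed by $\{0,\dots,d\}$ is called (upward) skip-free if $A(i,j)=0$ whenever $j>i+1$. For a chain $X$ on $\{0,\dots,d\}$ with stationary distribution $\pi$, the time-reversal of its transition matrix or generator $A$ is $\tilde A(x,y)=\pi(y)A(y,x)/\pi(x)$. A transition matrix $K$ is stochastically monotone if $Kf$ is nondecreasing for every nondecreasing $f:\{0,\dots,d\}\to\mathbb R$. A strong stationary time (SST) for $X$ is an almost surely finite randomized stopping time $T$ (that is, a stopping time of some filtration relative to which $X$ is a Markov chain) such that $X_T$ has distribution $\pi$ and is independent of $T$. An SST $T$ is fastest if $\mathbf P(T'\le t)\le \mathbf P(T\le t)$ for all $t$ and every SST $T'$ of a chain with the same transition mechanism and the same initial state, on any probability space. Eigenvalues are complex and are listed with algebraic multiplicity. (a) Let $X$ be an irreducible continuous-time Markov chain on $\{0,\dots,d\}$ with right-continuous paths, $X(0)=0$ and skip-free generator $G$, and suppose that its time-reversal is stochastically monotone, i.e. $e^{t\tilde G}$ is stochastically monotone for every $t\ge 0$. Then $-G$ has exactly $d$ nonzero eigenvalues $\nu_0,\dots,\nu_{d-1}$, they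 all have positive real part, and every fastest SST $T$ for $X$ has Laplace transform $$\mathbf E\,e^{-uT}=\prod_{j=0}^{d-1}\frac{\nu_j}{\nu_j+u},\qquad u\in\mathbb C,\ \operatorname{Re}u\ge 0.$$ In particular, if all $\nu_j$ are real, then the law of $T$ is the convolution of the Exponential$(\nu_j)$ distributions, $j=0,\dots,d-1$. (b) Let $X$ be an irreducible and aperiodic discrete-time Markov chain on $\{0,\dots,d\}$ with $X(0)=0$ and skip-free transition matrix $P$, and suppose that its time-reversal $\tilde P$ is stochastically monotone. Then $P$ has exactly $d$ eigenvalues $\theta_0,\dots,\theta_{d-1}$ different from $1$, they all have modulus less than $1$, and every fastest SST $T$ for $X$ has probability generating function $$\mathbf E\,u^{T}=\prod_{j=0}^{d-1}\frac{(1-\theta_j)u}{1-\theta_j u},\qquad u\in\mathbb C,\ |u|\le 1.$$ In particular, if all $\theta_j$ are real and nonnegative, then the law of $T$ is the convolution of the Geometric$(1-\theta_j)$ distributions on $\{1,2,\dots\}$, $j=0,\dots,d-1$. -/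

import Mathlib

open MeasureTheory ProbabilityTheory
open scoped NNReal ENNReal

universe u

namespace SkipFree

variable {d : ℕ}

/-- Upward skip-free: no upward jump of size larger than one (for transition matrices as well as
for generators). -/
def IsSkipFree (A : Matrix (Fin (d + 1)) (Fin (d + 1)) ℝ) : Prop :=
  ∀ i j : Fin (d + 1), (i : ℕ) + 1 < (j : ℕ) → A i j = 0

/-- Generator of a continuous-time Markov chain on `{0, …, d}`. -/
structure IsGenerator (G : Matrix (Fin (d + 1)) (Fin (d + 1)) ℝ) : Prop where
  nonneg : ∀ i j, i ≠ j → 0 ≤ G i j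
  row_sum : ∀ i, ∑ j, G i j = 0

/-- Irreducibility: every state can be reached from every state through a (possibly empty) chain of
jumps with positive rate or probability. For a generator, `0 < A a b` forces `a ≠ b`. -/
def IsIrreducible (A : Matrix (Fin (d + 1)) (Fin (d + 1)) ℝ) : Prop :=
  ∀ i j, Relation.ReflTransGen (fun a b => 0 < A a b) i j

/-- Aperiodicity: for every state `i`, the set of possible return times to `i` has greatest common
divisor `1`. -/
def IsAperiodic (P : Matrix (Fin (d + 1)) (Fin (d + 1)) ℝ) : Prop :=
  ∀ i, ∀ k : ℕ, (∀ n : ℕ, 0 < n → 0 < (P ^ n) i i → k ∣ n) → k = 1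

/-- Probability vectors on `{0, …, d}`. -/
structure IsProbVec (π : Fin (d + 1) → ℝ) : Prop where
  nonneg : ∀ i, 0 ≤ π i
  sum_eq_one : ∑ i, π i = 1

/-- Time-reversal of a transition matrix or of a generator with stationary distribution `π`. -/
noncomputable def timeReversal (π : Fin (d + 1) → ℝ) (A : Matrix (Fin (d + 1)) (Fin (d + 1)) ℝ) :
    Matrix (Fin (d + 1)) (Fin (d + 1)) ℝ :=
  Matrix.of fun x y => π y * A y x / π x

/-- A transition matrix is stochastically monotone if it maps increasing functions to increasing
functions. -/
def IsStochMonotone (K : Matrix (Fin (d + 1)) (Fin (d + 1)) ℝ) : Prop :=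
  ∀ f : Fin (d + 1) → ℝ, Monotone f → Monotone (K.mulVec f)

/-- Discrete-time transition function: `p_n = P ^ n`. -/
def discreteTransition (P : Matrix (Fin (d + 1)) (Fin (d + 1)) ℝ) (n : ℕ) :
    Matrix (Fin (d + 1)) (Fin (d + 1)) ℝ :=
  P ^ n

/-- Continuous-time transition function: `p_t = exp (t G)`. -/
noncomputable def continuousTransition (G : Matrix (Fin (d + 1)) (Fin (d + 1)) ℝ) (t : ℝ≥0) :
    Matrix (Fin (d + 1)) (Fin (d + 1)) ℝ :=
  NormedSpace.exp ((t : ℝ) • G)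

/-- The complex eigenvalues of a real matrix, listed with algebraic multiplicity. -/
noncomputable def eigenvalues (A : Matrix (Fin (d + 1)) (Fin (d + 1)) ℝ) : Multiset ℂ :=
  (A.map (fun x : ℝ => (x : ℂ))).charpoly.roots

section TimeSet

/- The time set `ι` is `ℕ` (discrete time) or `ℝ≥0` (continuous time). -/
variable {ι : Type} [LinearOrder ι] [Zero ι] [Add ι] [TopologicalSpace ι]
  [OrderTopology ι]

/-- `X` is a Markov chain on `{0, …, d}` with transition function `p`, started at `0`, relative to
the filtration `𝓕`, under the probability measure `μ`. The filtration may be larger than the one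
generated by `X`. Paths are right-continuous (no condition when `ι = ℕ`). -/
structure IsMarkovChain {Ω : Type u} {m : MeasurableSpace Ω}
    (p : ι → Matrix (Fin (d + 1)) (Fin (d + 1)) ℝ) (μ : Measure Ω) (𝓕 : Filtration ι m)
    (X : ι → Ω → Fin (d + 1)) : Prop where
  isProbabilityMeasure : IsProbabilityMeasure μ
  adapted : ∀ t, Measurable[𝓕 t] (X t)
  start : ∀ᵐ ω ∂μ, X 0 ω = 0
  markov : ∀ s t (A : Set Ω), MeasurableSet[𝓕 s] A → ∀ x y,
    μ.real (A ∩ {ω | X s ω = x} ∩ {ω | X (s + t) ω = y}) =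
      μ.real (A ∩ {ω | X s ω = x}) * p t x y
  rightContinuous : ∀ ω t, ContinuousWithinAt (fun s => X s ω) (Set.Ici t) t

/-- `T` is a strong stationary time for the chain `X` with transition function `p` and initial
state `0`, where `π` is the stationary distribution: a randomized stopping time (a stopping time
of some filtration relative to which `X` is Markov), almost surely finite, such that `X_T` has
distribution `π` and is independent of `T`. -/
def IsStrongStationaryTime {Ω : Type u} {m : MeasurableSpace Ω}
    (p : ι → Matrix (Fin (d + 1)) (Fin (d + 1)) ℝ) (π : Fin (d + 1) → ℝ) (μ : Measure Ω)
    (X : ι → Ω → Fin (d + 1)) (T : Ω → WithTop ι) : Prop :=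
  ∃ 𝓕 : Filtration ι m, IsMarkovChain p μ 𝓕 X ∧ IsStoppingTime 𝓕 T ∧
    (∀ᵐ ω ∂μ, T ω ≠ ⊤) ∧
    (∀ x, μ.real {ω | stoppedValue X T ω = x} = π x) ∧
    IndepFun T (stoppedValue X T) μ

/-- `T` is a fastest strong stationary time: it is stochastically smallest among all strong
stationary times of all versions of the chain, on arbitrary probability spaces. -/
def IsFastestStrongStationaryTime {Ω : Type u} {m : MeasurableSpace Ω}
    (p : ι → Matrix (Fin (d + 1)) (Fin (d + 1)) ℝ) (π : Fin (d + 1) → ℝ) (μ : Measure Ω)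
    (X : ι → Ω → Fin (d + 1)) (T : Ω → WithTop ι) : Prop :=
  IsStrongStationaryTime p π μ X T ∧
    ∀ (Ω' : Type u) (_ : MeasurableSpace Ω') (μ' : Measure Ω') (X' : ι → Ω' → Fin (d + 1))
      (T' : Ω' → WithTop ι), IsStrongStationaryTime p π μ' X' T' →
        ∀ t : ι, μ' {ω | T' ω ≤ t} ≤ μ {ω | T ω ≤ t}

end TimeSet

/-- Convolution of the exponential distributions with rates `r 0, …, r (d - 1)`, that is, the law
of a sum of independent exponential random variables. -/
noncomputable def expConvolution (r : Fin d → ℝ) : Measure ℝ :=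
  (Measure.pi fun j => expMeasure (r j)).map fun x => ∑ j, x j

/-- Geometric distribution on `{1, 2, …}` with success probability `p`. -/
noncomputable def geometricFromOne (p : unitInterval) : Measure ℕ :=
  (geometricMeasure p).map fun n => n + 1

/-- Convolution of the geometric distributions on `{1, 2, …}` with success probabilities
`p 0, …, p (d - 1)`. -/
noncomputable def geomConvolution (p : Fin d → unitInterval) : Measure ℕ :=
  (Measure.pi fun j => geometricFromOne (p j)).map fun x => ∑ j, x j

end SkipFree

/-! The proof computes the distribution function of a fastest strong stationary time and then its
transform.

Distribution function. If `T` is a strong stationary time, then on `{T ≤ t}` the chain at time `t`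
has conditional law `π`, so `P(T ≤ t) π y ≤ p t 0 y` for every `y` (`measureReal_le_mul_le`).
Monotonicity of the reversal says that `p t 0 y / π y`, which is proportional to the reversed
probability of going from `y` to `0`, is smallest at `y = d` (`corner_le_of_monotone`). Hence `P(T ≤
t) ≤ p t 0 d / π d`. For a fixed `t` the bound is attained by a strong stationary time with values
in a sequence of epochs starting at `t`, built with one extra uniform variable
(`exists_isStrongStationaryTime`). A fastest time must beat this competitor for each `t`, so `P(T ≤
t) = p t 0 d / π d` (`measureReal_fastest_le`). Continuous time thus needs no construction beyond a
countable set of epochs.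

Transform. The Laplace transform of `p t 0 d` is the corner entry of the resolvent of `G`. For a
skip-free matrix the corresponding cofactor is triangular, so this entry is the product of the
superdiagonal divided by `det (z - G)` (`corner_of_vecMul_eq`). By `charpoly_neg_factor`, `det (z -
G) = z ∏ (z + ν)` and `π d ∏ ν` is the product of the superdiagonal, so everything but `∏ ν / (ν +
z)` cancels. Discrete time uses the generator `P - 1` at the point `z⁻¹ - 1`. The boundary of the
domain is reached by continuity, and the real case follows by uniqueness of characteristic
functions. -/

namespace SkipFree

/-! ### Determinants, cofactors and eigenvalues of skip-free matrices and generators. -/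

section Algebra

variable {d : ℕ}

open Matrix Polynomial

/-- The corner cofactor of a skip-free matrix is the product of its superdiagonal, up to sign. -/
lemma adjugate_zero_last {R : Type*} [CommRing R] (A : Matrix (Fin (d + 1)) (Fin (d + 1)) R)
    (hA : ∀ i j : Fin (d + 1), (i : ℕ) + 1 < (j : ℕ) → A i j = 0) :
    A.adjugate 0 (Fin.last d) = (-1) ^ d * ∏ i : Fin d, A i.castSucc i.succ := by
  have h := Matrix.adjugate_fin_succ_eq_det_submatrix A 0 (Fin.last d)
  -- Deleting the last row and column `0` leaves the entries `A i.castSucc j.succ`: a lower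
  -- triangular matrix whose diagonal is the superdiagonal of `A`.
  rw [h, Matrix.det_of_isLowerTriangular]
  · simp
  · intro i j hij
    have hij : i < j := hij
    apply hA
    simpa using hij

/-- Row `j` of `A *ᵥ v = 0` involves only `v 0, …, v (j + 1)`, and the coefficient of the last one
is nonzero. After subtracting the constant `v 0`, which the zero row sums allow, each row forces the
next difference to vanish. -/
lemma eq_of_mulVec_eq_zero {K : Type*} [Field K] (A : Matrix (Fin (d + 1)) (Fin (d + 1)) K)
    (hA : ∀ i j : Fin (d + 1), (i : ℕ) + 1 < (j : ℕ) → A i j = 0)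
    (hsum : ∀ i, ∑ j, A i j = 0) (hpos : ∀ i : Fin d, A i.castSucc i.succ ≠ 0)
    (v : Fin (d + 1) → K) (hv : A *ᵥ v = 0) (i : Fin (d + 1)) : v i = v 0 := by
  suffices H : ∀ n : ℕ, ∀ i : Fin (d + 1), (i : ℕ) = n → v i = v 0 from H _ _ rfl
  intro n
  induction n using Nat.strong_induction_on with
  | _ n ih =>
    intro i hi
    cases i using Fin.cases with
    | zero => rfl
    | succ j =>
      have h1 : ∑ k, A j.castSucc k * (v k - v 0) = 0 := by
        have h2 : ∑ k, A j.castSucc k * v k = 0 := congrFun hv j.castSucc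
        simp_rw [mul_sub]
        rw [Finset.sum_sub_distrib, h2, ← Finset.sum_mul, hsum]
        simp
      rw [Finset.sum_eq_single j.succ] at h1
      · have h2 := (mul_eq_zero.1 h1).resolve_left (hpos j)
        exact sub_eq_zero.1 h2
      · intro k _ hk
        rcases lt_or_ge (k : ℕ) n with hkn | hkn
        · rw [ih k hkn k rfl]; simp
        · rw [hA, zero_mul]
          have : (k : ℕ) ≠ (j.succ : ℕ) := fun h => hk (Fin.ext h)
          simp at hi this ⊢
          omega
      · simp

/-- The characteristic polynomial of `-G` for an irreducible skip-free generator `G`: zero is a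
simple root, and the product of the other roots is explicit. -/
lemma charpoly_neg_factor (A : Matrix (Fin (d + 1)) (Fin (d + 1)) ℂ) (π : Fin (d + 1) → ℂ)
    (hA : ∀ i j : Fin (d + 1), (i : ℕ) + 1 < (j : ℕ) → A i j = 0)
    (hsum : ∀ i, ∑ j, A i j = 0) (hpos : ∀ i : Fin d, A i.castSucc i.succ ≠ 0)
    (hπ : π ᵥ* A = 0) (hπ1 : ∑ i, π i = 1) (hlast : π (Fin.last d) ≠ 0)
    (ν : Multiset ℂ) (hν : ν = (-A).charpoly.roots.filter (fun z => z ≠ 0)) :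
    Multiset.card ν = d ∧ (∀ z : ℂ, (scalar (Fin (d + 1)) z - A).det = z * (ν.map (z + ·)).prod) ∧
      ν.prod * π (Fin.last d) = ∏ i : Fin d, A i.castSucc i.succ := by
  set M := (-A).charmatrix with hM
  set χ := (-A).charpoly with hχ
  -- Here `M = X + A`, so `π ᵥ* A = 0` makes `π` a left eigenvector of `M` with eigenvalue `X`.
  -- Multiplying by the adjugate then exhibits the factor `X` of `χ`, with an explicit cofactor `S`.
  have h1 : (fun x => C (π x)) ᵥ* M = (X : ℂ[X]) • (fun x => C (π x)) := by
    ext1 j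
    have h2 : ∑ x, π x * A x j = 0 := congrFun hπ j
    simp only [Matrix.vecMul, dotProduct, Pi.smul_apply, smul_eq_mul, hM, Matrix.charmatrix,
      Matrix.sub_apply, mul_sub, Finset.sum_sub_distrib]
    have h3 : ∑ x, C (π x) * (C.mapMatrix (-A)) x j = 0 := by
      have h4 : ∀ x, C (π x) * (C.mapMatrix (-A)) x j = C (-(π x * A x j)) := fun x => by simp
      rw [Finset.sum_congr rfl fun x _ => h4 x, ← map_sum, Finset.sum_neg_distrib, h2]
      simp
    rw [h3, sub_zero, Finset.sum_eq_single j]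
    · rw [Matrix.scalar_apply, Matrix.diagonal_apply_eq, mul_comm]
    · intro b _ hb
      simp [Matrix.scalar_apply, Matrix.diagonal_apply_ne _ hb]
    · simp
  set S : ℂ[X] := ∑ x, C (π x) * M.adjugate x (Fin.last d) with hS
  have h2 : χ * C (π (Fin.last d)) = X * S := by
    have h3 : ((fun x => C (π x)) ᵥ* M) ᵥ* M.adjugate = χ • (fun x => C (π x)) := by
      rw [Matrix.vecMul_vecMul, Matrix.mul_adjugate, Matrix.vecMul_smul, Matrix.vecMul_one]
      rfl
    rw [h1, Matrix.smul_vecMul] at h3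
    have h4 := congrFun h3 (Fin.last d)
    simp only [Pi.smul_apply, smul_eq_mul] at h4
    rw [← h4]
    rfl
  have hdetA : A.det = 0 := by
    rw [← Matrix.exists_mulVec_eq_zero_iff]
    refine ⟨fun _ => 1, fun h => one_ne_zero (congrFun h 0), ?_⟩
    ext i
    simpa [Matrix.mulVec, dotProduct] using hsum i
  have hadj : ∀ x y, (M.adjugate x y).eval 0 = A.adjugate x y := by
    intro x y
    have h3 : (evalRingHom (0 : ℂ)).mapMatrix M = A := by
      ext i j
      by_cases hij : i = j
      · subst hij; simp [hM]
      · simp [hM, Matrix.charmatrix_apply_ne _ _ _ hij]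
    have h4 := RingHom.map_adjugate (evalRingHom (0 : ℂ)) M
    rw [h3] at h4
    rw [← h4]
    rfl
  -- Since `A * A.adjugate = 0`, every column of the adjugate lies in the kernel of `A`, which
  -- consists of constants. So at `0` the sum `S` reduces to the single triangular corner cofactor.
  have hcol : ∀ x, A.adjugate x (Fin.last d) = A.adjugate 0 (Fin.last d) := by
    apply eq_of_mulVec_eq_zero A hA hsum hpos (fun x => A.adjugate x (Fin.last d))
    ext i
    have := congrFun (congrFun (Matrix.mul_adjugate A) i) (Fin.last d)
    rw [hdetA, zero_smul] at this
    exact this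
  have hS0 : S.eval 0 = (-1) ^ d * ∏ i : Fin d, A i.castSucc i.succ := by
    rw [hS, eval_finsetSum]
    simp only [eval_mul, eval_C, hadj, hcol]
    rw [← Finset.sum_mul, hπ1, one_mul, adjugate_zero_last A hA]
  set q : ℂ[X] := S * C (π (Fin.last d))⁻¹ with hq
  have hχq : χ = X * q := by
    rw [hq, ← mul_assoc, ← h2, mul_assoc, ← C_mul, mul_inv_cancel₀ hlast]; simp
  have hq0 : q.eval 0 * π (Fin.last d) = (-1) ^ d * ∏ i : Fin d, A i.castSucc i.succ := by
    rw [hq, eval_mul, eval_C, hS0, mul_assoc, inv_mul_cancel₀ hlast, mul_one]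
  have hq0' : q.eval 0 ≠ 0 := by
    intro h
    rw [h, zero_mul] at hq0
    exact (mul_ne_zero (pow_ne_zero _ (by norm_num))
      (Finset.prod_ne_zero_iff.2 fun i _ => hpos i)) hq0.symm
  have hχ0 : χ ≠ 0 := (Matrix.charpoly_monic _).ne_zero
  have hqm : q.Monic := by
    have := Matrix.charpoly_monic (-A)
    rw [← hχ, hχq] at this
    exact (Polynomial.monic_X.of_mul_monic_left this)
  have hroots : χ.roots = {0} + q.roots := by
    rw [hχq, roots_mul (hχq ▸ hχ0), roots_X]
  have hνq : ν = q.roots := by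
    rw [hν, hroots, Multiset.filter_add]
    have h3 : Multiset.filter (fun z : ℂ => z ≠ 0) {0} = 0 := by simp
    rw [h3, zero_add, Multiset.filter_eq_self]
    rintro z hz rfl
    exact hq0' (isRoot_of_mem_roots hz)
  have hqprod : q = (ν.map (fun a => X - C a)).prod := by
    rw [hνq]
    exact (IsAlgClosed.splits q).eq_prod_roots_of_monic hqm
  have hcard : Multiset.card ν = d := by
    have h3 : χ.natDegree = d + 1 := by
      rw [hχ, Matrix.charpoly_natDegree_eq_dim]; simp
    have h4 : Multiset.card χ.roots = d + 1 := by
      rw [← h3]; exact (IsAlgClosed.splits χ).natDegree_eq_card_roots.symm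
    rw [hroots, ← hνq] at h4
    simp at h4
    omega
  have hqeval : ∀ z : ℂ, q.eval z = (ν.map (fun a => z - a)).prod := by
    intro z
    conv_lhs => rw [hqprod, eval_multiset_prod, Multiset.map_map]
    simp
  refine ⟨hcard, fun z => ?_, ?_⟩
  · have h3 : χ.eval (-z) = (scalar (Fin (d + 1)) (-z) - -A).det := Matrix.eval_charpoly _ _
    have h4 : scalar (Fin (d + 1)) (-z) - -A = -(scalar (Fin (d + 1)) z - A) := by
      rw [map_neg]; abel
    rw [h4, Matrix.det_neg, hχq, eval_mul, eval_X, hqeval] at h3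
    have h5 : (ν.map (fun a => -z - a)).prod = (-1) ^ d * (ν.map (z + ·)).prod := by
      have : (fun a : ℂ => -z - a) = fun a => (-1) * (z + a) := by ext; ring
      rw [this, Multiset.prod_map_mul]
      simp [hcard]
    rw [h5, Fintype.card_fin, pow_succ] at h3
    have h6 : ((-1 : ℂ) ^ d) ≠ 0 := pow_ne_zero _ (by norm_num)
    apply mul_left_cancel₀ h6
    linear_combination h3
  · have h5 : q.eval 0 = (-1) ^ d * ν.prod := by
      rw [hqeval]
      have : (fun a : ℂ => 0 - a) = fun a => (-1) * a := by ext; ring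
      rw [this, Multiset.prod_map_mul]
      simp [hcard]
    rw [h5] at hq0
    have h6 : ((-1 : ℂ) ^ d) ≠ 0 := pow_ne_zero _ (by norm_num)
    apply mul_left_cancel₀ h6
    linear_combination hq0

/-- Resolvent identity for the corner entry. -/
lemma corner_of_vecMul_eq (A : Matrix (Fin (d + 1)) (Fin (d + 1)) ℂ)
    (hA : ∀ i j : Fin (d + 1), (i : ℕ) + 1 < (j : ℕ) → A i j = 0) (z w : ℂ)
    (L : Fin (d + 1) → ℂ) (hL : L ᵥ* (scalar (Fin (d + 1)) z - A) = Pi.single 0 w) :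
    L (Fin.last d) * (scalar (Fin (d + 1)) z - A).det =
      w * ∏ i : Fin d, A i.castSucc i.succ := by
  set B := scalar (Fin (d + 1)) z - A with hB
  -- This is Cramer's rule: entry `d` of the identity involves only the cofactor `B.adjugate 0
  -- (Fin.last d)`.
  have h1 : (L ᵥ* B) ᵥ* B.adjugate = B.det • L := by
    rw [Matrix.vecMul_vecMul, Matrix.mul_adjugate, Matrix.vecMul_smul, Matrix.vecMul_one]
  rw [hL] at h1
  have h2 := congrFun h1 (Fin.last d)
  have hne : ∀ i j : Fin (d + 1), i ≠ j → B i j = - A i j := by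
    intro i j hij
    simp [hB, Matrix.scalar_apply, Matrix.diagonal_apply_ne _ hij]
  have hB' : ∀ i j : Fin (d + 1), (i : ℕ) + 1 < (j : ℕ) → B i j = 0 := by
    intro i j hij
    rw [hne i j (fun h => by subst h; omega), hA i j hij, neg_zero]
  have h3 : ∏ i : Fin d, B i.castSucc i.succ = (-1) ^ d * ∏ i : Fin d, A i.castSucc i.succ := by
    rw [Finset.prod_congr rfl fun i _ => hne i.castSucc i.succ (fun h => by
      have := congrArg Fin.val h; simp at this), Finset.prod_neg]
    simp
  simp only [Matrix.single_vecMul, Pi.smul_apply, smul_eq_mul] at h2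
  rw [mul_comm, ← h2, Matrix.row_apply, adjugate_zero_last B hB', h3, ← mul_assoc ((-1 : ℂ) ^ d),
    ← mul_pow]
  simp

/-- Upward skip-free irreducible matrices have positive superdiagonal. -/
lemma superdiag_pos {A : Matrix (Fin (d + 1)) (Fin (d + 1)) ℝ} (hirr : IsIrreducible A)
    (hskip : IsSkipFree A) (i : Fin d) : 0 < A i.castSucc i.succ := by
  by_contra hneg
  -- Without the jump from `i` to `i + 1`, the set `{0, …, i}` could never be left.
  have key : ∀ b, Relation.ReflTransGen (fun a b => 0 < A a b) i.castSucc b → (b : ℕ) ≤ i := by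
    intro b hb
    induction hb with
    | refl => simp
    | tail _ hbc ih =>
      rename_i b c _
      by_contra hc
      have h1 : ¬ ((b : ℕ) + 1 < c) := fun h => by
        rw [hskip b c h] at hbc; exact lt_irrefl _ hbc
      have hb' : b = i.castSucc := Fin.ext (by simp; omega)
      have hc' : c = i.succ := Fin.ext (by simp; omega)
      subst hb' hc'
      exact hneg hbc
  have := key _ (hirr i.castSucc i.succ)
  simp at this

/-- Positivity spreads along jumps: if `π c = 0`, the balance equation at `c` is a vanishing sum of
nonnegative terms, so no state of positive mass can jump to `c`. -/
lemma stationary_pos {G : Matrix (Fin (d + 1)) (Fin (d + 1)) ℝ} {π : Fin (d + 1) → ℝ}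
    (hG : IsGenerator G) (hirr : IsIrreducible G) (hπ : IsProbVec π) (hst : π ᵥ* G = 0)
    (y : Fin (d + 1)) : 0 < π y := by
  obtain ⟨x, hx⟩ : ∃ x, 0 < π x := by
    by_contra! h
    have := Finset.sum_nonpos fun i (_ : i ∈ Finset.univ) => h i
    rw [hπ.sum_eq_one] at this
    linarith
  have hxy := hirr x y
  induction hxy with
  | refl => exact hx
  | tail _ hbc ih =>
    rename_i b c _
    by_cases hne : b = c
    · subst hne; exact ih
    rcases (hπ.nonneg c).lt_or_eq with h | h
    · exact h
    exfalso
    have h1 : ∑ a, π a * G a c = 0 := congrFun hst c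
    have h2 : ∀ a ∈ Finset.univ, 0 ≤ π a * G a c := by
      intro a _
      by_cases hac : a = c
      · subst hac; simp [← h]
      · exact mul_nonneg (hπ.nonneg a) (hG.nonneg a c hac)
    have h3 := (Finset.sum_eq_zero_iff_of_nonneg h2).1 h1 b (Finset.mem_univ b)
    exact (mul_pos ih hbc).ne' h3

lemma exists_eigenvector {A : Matrix (Fin (d + 1)) (Fin (d + 1)) ℂ} {z : ℂ}
    (hz : z ∈ A.charpoly.roots) : ∃ v, v ≠ 0 ∧ A *ᵥ v = z • v := by
  have h := isRoot_of_mem_roots hz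
  rw [IsRoot, Matrix.eval_charpoly, ← Matrix.exists_mulVec_eq_zero_iff] at h
  obtain ⟨v, hv, h⟩ := h
  refine ⟨v, hv, ?_⟩
  rw [Matrix.sub_mulVec, sub_eq_zero] at h
  rw [← h]
  ext i
  simp [Matrix.scalar_apply, Matrix.mulVec_diagonal]

/-- By Gershgorin, each eigenvalue lies in a disc with centre `-G k k` and radius `-G k k`, and such
a disc meets the closed left half-plane only at `0`. -/
lemma re_pos_of_mem_eigenvalues_neg {G : Matrix (Fin (d + 1)) (Fin (d + 1)) ℝ}
    (hG : IsGenerator G) {z : ℂ} (hz : z ∈ eigenvalues (-G)) (hz0 : z ≠ 0) : 0 < z.re := by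
  obtain ⟨v, hv, h⟩ := exists_eigenvector hz
  have hev : Module.End.HasEigenvalue (Matrix.toLin' ((-G).map (fun x : ℝ => (x : ℂ)))) z :=
    Module.End.hasEigenvalue_of_hasEigenvector
      ⟨Module.End.mem_eigenspace_iff.2 (by simpa [Matrix.toLin'_apply] using h), hv⟩
  obtain ⟨k, hk⟩ := eigenvalue_mem_ball hev
  have h1 : ∑ j ∈ Finset.univ.erase k, ‖((-G).map (fun x : ℝ => (x : ℂ))) k j‖ = -G k k := by
    have h2 : ∀ j ∈ Finset.univ.erase k, ‖((-G).map (fun x : ℝ => (x : ℂ))) k j‖ = G k j := by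
      intro j hj
      have := hG.nonneg k j (Finset.ne_of_mem_erase hj).symm
      simp [abs_of_nonneg this]
    rw [Finset.sum_congr rfl h2]
    have := hG.row_sum k
    rw [← Finset.add_sum_erase _ _ (Finset.mem_univ k)] at this
    linarith
  rw [h1, Metric.mem_closedBall, dist_eq_norm] at hk
  set a := -G k k with ha
  have hkk : ((-G).map (fun x : ℝ => (x : ℂ))) k k = (a : ℂ) := by simp [ha]
  rw [hkk] at hk
  have ha0 : 0 ≤ a := (norm_nonneg _).trans hk
  have h3 : (z.re - a) ^ 2 + z.im ^ 2 ≤ a ^ 2 := by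
    have := pow_le_pow_left₀ (norm_nonneg _) hk 2
    rw [Complex.sq_norm, Complex.normSq_apply] at this
    simp at this
    nlinarith
  by_contra hneg
  push Not at hneg
  have h4 : z.re = 0 := by nlinarith [sq_nonneg z.re, sq_nonneg z.im]
  have h5 : z.im = 0 := by rw [h4] at h3; nlinarith [sq_nonneg z.im]
  exact hz0 (Complex.ext h4 h5)

end Algebra

/-! ### Transition semigroups, time reversal and the minimal likelihood ratio. -/

section Semigroup

variable {d : ℕ}

open Matrix

/-- A Markov transition semigroup on `{0, …, d}` with stationary distribution `π`, for which the
likelihood ratio `p t 0 y / π y` is smallest at the top state. -/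
structure IsStationarySemigroup {ι : Type} [Add ι]
    (p : ι → Matrix (Fin (d + 1)) (Fin (d + 1)) ℝ) (π : Fin (d + 1) → ℝ) : Prop where
  add : ∀ s t, p (s + t) = p s * p t
  nonneg : ∀ t x y, 0 ≤ p t x y
  row_sum : ∀ t x, ∑ y, p t x y = 1
  stationary : ∀ t, π ᵥ* p t = π
  pos : ∀ x, 0 < π x
  sum_eq_one : ∑ x, π x = 1
  corner_le : ∀ t y, p t 0 (Fin.last d) * π y ≤ p t 0 y * π (Fin.last d)

lemma IsStationarySemigroup.le_one {ι : Type} [Add ι]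
    {p : ι → Matrix (Fin (d + 1)) (Fin (d + 1)) ℝ} {π : Fin (d + 1) → ℝ}
    (hp : IsStationarySemigroup p π) (t : ι) (x y : Fin (d + 1)) : p t x y ≤ 1 := by
  rw [← hp.row_sum t x]
  exact Finset.single_le_sum (fun z _ => hp.nonneg t x z) (Finset.mem_univ y)

/-- Testing monotonicity on the indicator of the nonzero states shows that the reversed probability
`π 0 * K 0 y / π y` of moving from `y` to `0` decreases in `y`. -/
lemma corner_le_of_monotone {K : Matrix (Fin (d + 1)) (Fin (d + 1)) ℝ} {π : Fin (d + 1) → ℝ}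
    (hpos : ∀ x, 0 < π x) (hst : π ᵥ* K = π) (hmono : IsStochMonotone (timeReversal π K))
    (y : Fin (d + 1)) : K 0 (Fin.last d) * π y ≤ K 0 y * π (Fin.last d) := by
  have hrow : ∀ x, ∑ z, timeReversal π K x z = 1 := by
    intro x
    have h1 : ∑ z, π z * K z x = π x := congrFun hst x
    simp only [timeReversal, Matrix.of_apply]
    rw [← Finset.sum_div, h1, div_self (hpos x).ne']
  have hf : Monotone (fun j : Fin (d + 1) => if j = 0 then (0 : ℝ) else 1) := by
    intro a b hab
    by_cases hb : b = 0
    · have ha : a = 0 := by subst hb; exact Fin.le_zero_iff.1 hab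
      simp [ha, hb]
    · simp only [hb, if_false]
      split_ifs <;> norm_num
  have hval : ∀ x, (timeReversal π K *ᵥ (fun j : Fin (d + 1) => if j = 0 then (0 : ℝ) else 1)) x
      = 1 - timeReversal π K x 0 := by
    intro x
    rw [eq_sub_iff_add_eq, ← hrow x, Matrix.mulVec, dotProduct]
    have h3 : timeReversal π K x 0 = ∑ z, if z = 0 then timeReversal π K x z else 0 := by simp
    rw [h3, ← Finset.sum_add_distrib]
    exact Finset.sum_congr rfl fun z _ => by split_ifs <;> simp [hrow x]
  have h := hmono _ hf (Fin.le_last y)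
  rw [hval, hval] at h
  have h2 : π 0 * K 0 (Fin.last d) / π (Fin.last d) ≤ π 0 * K 0 y / π y := by
    simp only [timeReversal, Matrix.of_apply] at h
    linarith
  rw [div_le_div_iff₀ (hpos _) (hpos _)] at h2
  have h0 := hpos 0
  nlinarith

/-- As transposition followed by a conjugation, reversal commutes with powers and with the
exponential; this carries monotonicity of the reversed mechanism to all times. -/
lemma timeReversal_eq_conj {π : Fin (d + 1) → ℝ} (hpos : ∀ x, 0 < π x)
    (A : Matrix (Fin (d + 1)) (Fin (d + 1)) ℝ) :
    timeReversal π A = (diagonal π)⁻¹ * Aᵀ * diagonal π := by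
  have : (diagonal π)⁻¹ = diagonal (fun x => (π x)⁻¹) := by
    apply Matrix.inv_eq_right_inv
    rw [Matrix.diagonal_mul_diagonal, ← Matrix.diagonal_one]
    congr 1
    ext x
    exact mul_inv_cancel₀ (hpos x).ne'
  ext x y
  rw [this, Matrix.mul_diagonal, Matrix.diagonal_mul]
  simp [timeReversal]
  ring

lemma isUnit_diagonal {π : Fin (d + 1) → ℝ} (hpos : ∀ x, 0 < π x) : IsUnit (diagonal π) := by
  rw [Matrix.isUnit_iff_isUnit_det, Matrix.det_diagonal, isUnit_iff_ne_zero]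
  exact Finset.prod_ne_zero_iff.2 fun x _ => (hpos x).ne'

lemma timeReversal_pow {π : Fin (d + 1) → ℝ} (hpos : ∀ x, 0 < π x)
    (A : Matrix (Fin (d + 1)) (Fin (d + 1)) ℝ) (n : ℕ) :
    timeReversal π (A ^ n) = timeReversal π A ^ n := by
  have hu := (Matrix.isUnit_iff_isUnit_det _).1 (isUnit_diagonal hpos)
  induction n with
  | zero =>
    rw [timeReversal_eq_conj hpos, pow_zero, Matrix.transpose_one, Matrix.mul_one,
      Matrix.nonsing_inv_mul _ hu, pow_zero]
  | succ n ih =>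
    rw [pow_succ (timeReversal π A), ← ih, timeReversal_eq_conj hpos, timeReversal_eq_conj hpos,
      timeReversal_eq_conj hpos, pow_succ', Matrix.transpose_mul]
    simp only [Matrix.mul_assoc]
    rw [Matrix.mul_nonsing_inv_cancel_left _ _ hu]

lemma IsStochMonotone.pow {K : Matrix (Fin (d + 1)) (Fin (d + 1)) ℝ} (hK : IsStochMonotone K)
    (n : ℕ) : IsStochMonotone (K ^ n) := by
  induction n with
  | zero => intro f hf; simpa using hf
  | succ n ih =>
    intro f hf
    rw [pow_succ, ← Matrix.mulVec_mulVec]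
    exact ih _ (hK f hf)

lemma timeReversal_exp {π : Fin (d + 1) → ℝ} (hpos : ∀ x, 0 < π x)
    (A : Matrix (Fin (d + 1)) (Fin (d + 1)) ℝ) (t : ℝ≥0) :
    timeReversal π (continuousTransition A t) = continuousTransition (timeReversal π A) t := by
  rw [continuousTransition, continuousTransition, timeReversal_eq_conj hpos,
    timeReversal_eq_conj hpos, ← Matrix.exp_transpose, ← Matrix.exp_conj' _ _ (isUnit_diagonal hpos),
    Matrix.transpose_smul, Matrix.mul_smul, Matrix.smul_mul]

lemma isStationarySemigroup_discrete {P : Matrix (Fin (d + 1)) (Fin (d + 1)) ℝ}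
    {π : Fin (d + 1) → ℝ} (hP : P ∈ Matrix.rowStochastic ℝ (Fin (d + 1)))
    (hpos : ∀ x, 0 < π x) (hsum : ∑ x, π x = 1) (hst : π ᵥ* P = π)
    (hmono : IsStochMonotone (timeReversal π P)) :
    IsStationarySemigroup (discreteTransition P) π := by
  have hPn : ∀ n, P ^ n ∈ Matrix.rowStochastic ℝ (Fin (d + 1)) := fun n => pow_mem hP n
  have hstn : ∀ n : ℕ, π ᵥ* P ^ n = π := by
    intro n
    induction n with
    | zero => simp
    | succ n ih => rw [pow_succ, ← Matrix.vecMul_vecMul, ih, hst]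
  refine ⟨fun s t => pow_add _ _ _, fun t x y => ?_, fun t x => ?_, hstn, hpos, hsum,
    fun t y => ?_⟩
  · exact (Matrix.mem_rowStochastic_iff_sum.1 (hPn t)).1 x y
  · exact (Matrix.mem_rowStochastic_iff_sum.1 (hPn t)).2 x
  · refine corner_le_of_monotone hpos (hstn t) ?_ y
    rw [timeReversal_pow hpos]
    exact hmono.pow t

section Exp

attribute [local instance] Matrix.linftyOpNormedRing Matrix.linftyOpNormedAlgebra

lemma exp_nonneg_of_nonneg {A : Matrix (Fin (d + 1)) (Fin (d + 1)) ℝ} (hA : ∀ x y, 0 ≤ A x y)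
    (x y : Fin (d + 1)) : 0 ≤ NormedSpace.exp A x y := by
  have h := NormedSpace.exp_series_hasSum_exp' (𝕂 := ℝ) A
  have h2 : HasSum (fun n : ℕ => ((n.factorial : ℝ)⁻¹ • A ^ n) x y) (NormedSpace.exp A x y) :=
    (h.map (Matrix.entryAddMonoidHom ℝ x y) (continuous_id.matrix_elem x y))
  have hpow : ∀ n : ℕ, ∀ x y, 0 ≤ (A ^ n) x y := by
    intro n
    induction n with
    | zero => intro x y; simp [Matrix.one_apply]; split_ifs <;> norm_num
    | succ n ih =>
      intro x y
      rw [pow_succ, Matrix.mul_apply]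
      exact Finset.sum_nonneg fun z _ => mul_nonneg (ih x z) (hA z y)
  exact h2.nonneg fun n => mul_nonneg (by positivity) (hpow n x y)

/-- Only the constant term of the exponential series survives on `v`. It serves for the constant
vector (row sums) and, after transposition, for `π` (stationarity). -/
lemma exp_mulVec_of_mulVec_eq_zero {A : Matrix (Fin (d + 1)) (Fin (d + 1)) ℝ}
    {v : Fin (d + 1) → ℝ} (hv : A *ᵥ v = 0) : NormedSpace.exp A *ᵥ v = v := by
  have h := NormedSpace.exp_series_hasSum_exp' (𝕂 := ℝ) A
  have h2 : HasSum (fun n : ℕ => ((n.factorial : ℝ)⁻¹ • A ^ n) *ᵥ v) (NormedSpace.exp A *ᵥ v) :=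
    h.map (Matrix.mulVec.addMonoidHomLeft v) (continuous_id.matrix_mulVec continuous_const)
  refine h2.unique ?_
  have h3 := hasSum_single (f := fun n : ℕ => ((n.factorial : ℝ)⁻¹ • A ^ n) *ᵥ v) 0 ?_
  · simpa using h3
  · intro n hn
    obtain ⟨m, rfl⟩ := Nat.exists_eq_succ_of_ne_zero hn
    simp only [Matrix.smul_mulVec, pow_succ, ← Matrix.mulVec_mulVec, hv]
    simp

lemma hasDerivAt_exp_entry (G : Matrix (Fin (d + 1)) (Fin (d + 1)) ℝ) (t : ℝ)
    (x y : Fin (d + 1)) :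
    HasDerivAt (fun t : ℝ => NormedSpace.exp (t • G) x y)
      (∑ z, NormedSpace.exp (t • G) x z * G z y) t := by
  have h := hasDerivAt_exp_smul_const G t
  have h2 := (hasDerivAt_pi.1 (hasDerivAt_pi.1 h x) y)
  exact h2

end Exp

lemma isStationarySemigroup_continuous {G : Matrix (Fin (d + 1)) (Fin (d + 1)) ℝ}
    {π : Fin (d + 1) → ℝ} (hG : IsGenerator G)
    (hpos : ∀ x, 0 < π x) (hsum : ∑ x, π x = 1) (hst : π ᵥ* G = 0)
    (hmono : ∀ t : ℝ≥0, IsStochMonotone (continuousTransition (timeReversal π G) t)) :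
    IsStationarySemigroup (continuousTransition G) π := by
  have hstt : ∀ t : ℝ≥0, π ᵥ* continuousTransition G t = π := by
    intro t
    have h : ((t : ℝ) • G)ᵀ *ᵥ π = 0 := by
      rw [Matrix.mulVec_transpose, Matrix.vecMul_smul, hst, smul_zero]
    have h2 := exp_mulVec_of_mulVec_eq_zero h
    rwa [Matrix.exp_transpose, Matrix.mulVec_transpose] at h2
  refine ⟨fun s t => ?_, fun t x y => ?_, fun t x => ?_, hstt, hpos, hsum, fun t y => ?_⟩
  · simp only [continuousTransition, NNReal.coe_add, add_smul]
    exact Matrix.exp_add_of_commute _ _ (((Commute.refl G).smul_left _).smul_right _)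
  -- Uniformization: adding `c` times the identity makes `G` entrywise nonnegative, at the cost of
  -- the positive scalar factor `exp (-(t * c))`.
  · set c : ℝ := ∑ x, |G x x| with hc
    have h1 : (t : ℝ) • G = (t : ℝ) • (G + c • (1 : Matrix _ _ ℝ)) +
        (-(t * c) : ℝ) • (1 : Matrix (Fin (d + 1)) (Fin (d + 1)) ℝ) := by
      rw [smul_add, smul_smul, neg_smul]; abel
    have h2 : NormedSpace.exp ((-(t * c) : ℝ) • (1 : Matrix (Fin (d + 1)) (Fin (d + 1)) ℝ)) =
        diagonal (fun _ => Real.exp (-(t * c))) := by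
      rw [← Matrix.diagonal_one, ← Matrix.diagonal_smul, Matrix.exp_diagonal]
      congr 1
      ext i
      simp [Real.exp_eq_exp_ℝ]
    rw [continuousTransition, h1, Matrix.exp_add_of_commute, h2, Matrix.mul_diagonal]
    · refine mul_nonneg (exp_nonneg_of_nonneg (fun x y => ?_) x y) (Real.exp_pos _).le
      refine mul_nonneg t.2 ?_
      by_cases hxy : x = y
      · subst hxy
        have : |G x x| ≤ c := Finset.single_le_sum (f := fun x => |G x x|)
          (fun i _ => abs_nonneg _) (Finset.mem_univ x)
        simp
        linarith [neg_abs_le (G x x)]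
      · simpa [hxy] using hG.nonneg x y hxy
    · exact ((Commute.one_right _).smul_left _).smul_right _
  · have h : ((t : ℝ) • G) *ᵥ (fun _ => (1 : ℝ)) = 0 := by
      rw [Matrix.smul_mulVec]
      ext i
      simp [Matrix.mulVec, dotProduct, hG.row_sum i]
    have h2 := congrFun (exp_mulVec_of_mulVec_eq_zero h) x
    simpa [Matrix.mulVec, dotProduct, continuousTransition] using h2
  · refine corner_le_of_monotone hpos (hstt t) ?_ y
    rw [timeReversal_exp hpos]
    exact hmono t

end Semigroup

/-! ### Upper bound for the distribution function of any strong stationary time. -/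

section UpperBound

variable {d : ℕ} {ι : Type} [LinearOrder ι]
  {Ω : Type u} {m : MeasurableSpace Ω} {μ : Measure Ω}
  {p : ι → Matrix (Fin (d + 1)) (Fin (d + 1)) ℝ} {π : Fin (d + 1) → ℝ}
  {X : ι → Ω → Fin (d + 1)} {T : Ω → WithTop ι} {𝓕 : Filtration ι m}

lemma sum_measureReal_inter_fiber [IsFiniteMeasure μ] (Y : Ω → Fin (d + 1)) (B : Set Ω)
    (hB : ∀ x, MeasurableSet (B ∩ {ω | Y ω = x})) :
    ∑ x, μ.real (B ∩ {ω | Y ω = x}) = μ.real B := by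
  rw [← measureReal_iUnion_fintype]
  · congr 1
    ext ω
    simp
  · intro x y hxy
    rw [Function.onFun, Set.disjoint_left]
    rintro ω ⟨_, h1⟩ ⟨_, h2⟩
    exact hxy (h1.symm.trans h2)
  · exact hB

/-- The event that `v` is the first point of the grid `S` at or after `T`. -/
def gridCell (T : Ω → WithTop ι) (S : Finset ι) (v : ι) : Set Ω :=
  T ⁻¹' (Set.Iic (v : WithTop ι) \ ⋃ w ∈ S.filter (· < v), Set.Iic (w : WithTop ι))

lemma mem_gridCell {S : Finset ι} {v : ι} {ω : Ω} :
    ω ∈ gridCell T S v ↔ T ω ≤ v ∧ ∀ w ∈ S, w < v → ¬ T ω ≤ w := by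
  simp [gridCell]

lemma measurableSet_gridCell (hT : IsStoppingTime 𝓕 T) (S : Finset ι) (v : ι) :
    MeasurableSet[𝓕 v] (gridCell T S v) := by
  have h : gridCell T S v = {ω | T ω ≤ v} \ ⋃ w ∈ S.filter (· < v), {ω | T ω ≤ w} := by
    ext ω; simp [gridCell]
  rw [h]
  refine (hT v).diff (Finset.measurableSet_biUnion _ fun w hw => ?_)
  exact 𝓕.mono (Finset.mem_filter.1 hw).2.le _ (hT w)

lemma pairwiseDisjoint_gridCell (S : Finset ι) :
    (S : Set ι).PairwiseDisjoint (gridCell T S) := by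
  intro v hv w hw hvw
  rw [Function.onFun, Set.disjoint_left]
  intro ω h1 h2
  rw [mem_gridCell] at h1 h2
  rcases lt_or_gt_of_ne hvw with h | h
  · exact h2.2 v hv h h1.1
  · exact h1.2 w hw h h2.1

lemma biUnion_gridCell {S : Finset ι} {t : ι} (ht : t ∈ S) (hS : ∀ v ∈ S, v ≤ t) :
    ⋃ v ∈ S, gridCell T S v = {ω | T ω ≤ t} := by
  ext ω
  simp only [Set.mem_iUnion, mem_gridCell, exists_prop, Set.mem_ofPred_eq]
  constructor
  · rintro ⟨v, hv, h, _⟩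
    exact h.trans (WithTop.coe_le_coe.2 (hS v hv))
  · intro h
    obtain ⟨v, hv, hmin⟩ := Finset.exists_min_image (S.filter fun v : ι => T ω ≤ (v : WithTop ι)) id
      ⟨t, Finset.mem_filter.2 ⟨ht, h⟩⟩
    rw [Finset.mem_filter] at hv
    refine ⟨v, hv.1, hv.2, fun w hw hwv hTw => ?_⟩
    exact absurd (hmin w (Finset.mem_filter.2 ⟨hw, hTw⟩)) (not_le.2 hwv)

/-- The finite grids of points at most `t` built from a sequence `q`. -/
def grid (q : ℕ → ι) (t : ι) (N : ℕ) : Finset ι :=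
  insert t (((Finset.range N).image q).filter (· ≤ t))

lemma mem_grid_self (q : ℕ → ι) (t : ι) (N : ℕ) : t ∈ grid q t N := Finset.mem_insert_self _ _

lemma le_of_mem_grid {q : ℕ → ι} {t v : ι} {N : ℕ} (hv : v ∈ grid q t N) : v ≤ t := by
  rcases Finset.mem_insert.1 hv with h | h
  · exact h.le
  · exact (Finset.mem_filter.1 h).2

variable [TopologicalSpace ι]

/-- Along refining grids, the chain at the first grid point after `T` is eventually `X_T`. -/
lemma eventually_gridCell_eq [OrderTopology ι] [Nonempty ι]
    (hrc : ∀ ω t, ContinuousWithinAt (fun s => X s ω) (Set.Ici t) t)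
    {q : ℕ → ι} (hq : ∀ s s', s < s' → ∃ n, s ≤ q n ∧ q n < s') (t : ι) (ω : Ω)
    (hω : T ω ≤ t) :
    ∀ᶠ N in Filter.atTop, ∀ v ∈ grid q t N, ω ∈ gridCell T (grid q t N) v →
      X v ω = X (T ω).untopA ω := by
  obtain ⟨s, hs⟩ : ∃ s : ι, (s : WithTop ι) = T ω :=
    WithTop.ne_top_iff_exists.1 (ne_top_of_le_ne_top WithTop.coe_ne_top hω)
  rw [← hs] at hω ⊢
  have hsA : ((s : WithTop ι)).untopA = s := rfl
  rw [hsA]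
  have hst : s ≤ t := WithTop.coe_le_coe.1 hω
  -- If `T = t`, the only possible cell is that of `t`. Otherwise the path is constant on some `[s,
  -- s')`, and fine grids contain a point `q n` there, so the first grid point after `T` falls in
  -- this interval.
  rcases hst.eq_or_lt with rfl | hst
  · refine Filter.Eventually.of_forall fun N v hv h => ?_
    rw [mem_gridCell, ← hs] at h
    rw [le_antisymm (le_of_mem_grid hv) (WithTop.coe_le_coe.1 h.1)]
  · have h1 : ∀ᶠ r in nhdsWithin s (Set.Ici s), X r ω = X s ω := by
      exact (hrc ω s) ((isOpen_discrete {X s ω}).mem_nhds rfl)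
    rw [Filter.Eventually, mem_nhdsGE_iff_exists_Ico_subset' hst] at h1
    obtain ⟨s', hs', hsub⟩ := h1
    obtain ⟨n, hn1, hn2⟩ := hq s (min s' t) (lt_min hs' hst)
    filter_upwards [Filter.eventually_gt_atTop n] with N hN v hv h
    rw [mem_gridCell, ← hs] at h
    have hqn : q n ∈ grid q t N := Finset.mem_insert_of_mem (Finset.mem_filter.2
      ⟨Finset.mem_image_of_mem _ (Finset.mem_range.2 hN), (hn2.trans_le (min_le_right _ _)).le⟩)
    have hv2 : v ≤ q n := by
      by_contra hlt
      exact h.2 _ hqn (not_le.1 hlt) (WithTop.coe_le_coe.2 hn1)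
    exact hsub ⟨WithTop.coe_le_coe.1 h.1, hv2.trans_lt (hn2.trans_le (min_le_left _ _))⟩

lemma measurableSet_stoppedValue_inter [OrderTopology ι] [Nonempty ι]
    (hrc : ∀ ω t, ContinuousWithinAt (fun s => X s ω) (Set.Ici t) t)
    (hX : ∀ t, Measurable[𝓕 t] (X t))
    (hT : IsStoppingTime 𝓕 T) {q : ℕ → ι} (hq : ∀ s s', s < s' → ∃ n, s ≤ q n ∧ q n < s')
    (t : ι) (x : Fin (d + 1)) :
    MeasurableSet ({ω | T ω ≤ t} ∩ {ω | stoppedValue X T ω = x}) := by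
  -- The event is the lower limit of its grid approximations, each a finite union of measurable
  -- sets.
  have h : {ω | T ω ≤ t} ∩ {ω | stoppedValue X T ω = x} =
      ⋃ M : ℕ, ⋂ N ∈ Set.Ici M, ⋃ v ∈ grid q t N,
        (gridCell T (grid q t N) v ∩ {ω | X v ω = x}) := by
    ext ω
    simp only [Set.mem_inter_iff, Set.mem_ofPred_eq, Set.mem_iUnion, Set.mem_iInter, exists_prop]
    constructor
    · rintro ⟨hω, hx⟩
      obtain ⟨M, hM⟩ := Filter.eventually_atTop.1 (eventually_gridCell_eq (T := T) hrc hq t ω hω)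
      refine ⟨M, fun N hN => ?_⟩
      have h1 : ω ∈ ⋃ v ∈ grid q t N, gridCell T (grid q t N) v := by
        rw [biUnion_gridCell (mem_grid_self q t N) fun v hv => le_of_mem_grid hv]
        exact hω
      simp only [Set.mem_iUnion, exists_prop] at h1
      obtain ⟨v, hv, h2⟩ := h1
      exact ⟨v, hv, h2, (hM N hN v hv h2).trans hx⟩
    · rintro ⟨M, hM⟩
      have hω : T ω ≤ t := by
        obtain ⟨v, hv, h2, -⟩ := hM M (le_refl M)
        exact (mem_gridCell.1 h2).1.trans (WithTop.coe_le_coe.2 (le_of_mem_grid hv))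
      obtain ⟨M', hM'⟩ := Filter.eventually_atTop.1 (eventually_gridCell_eq hrc hq t ω hω)
      obtain ⟨v, hv, h2, h3⟩ := hM (max M M') (Set.mem_Ici.2 (le_max_left _ _))
      exact ⟨hω, (hM' _ (le_max_right _ _) v hv h2).symm.trans h3⟩
  rw [h]
  refine MeasurableSet.iUnion fun M => MeasurableSet.biInter (Set.to_countable _) fun N _ =>
    Finset.measurableSet_biUnion _ fun v _ => ?_
  exact 𝓕.le v _ ((measurableSet_gridCell hT _ v).inter (hX v (measurableSet_singleton x)))

variable [AddCommMonoid ι]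

lemma IsMarkovChain.measurableSet_eq (hX : IsMarkovChain p μ 𝓕 X) (s : ι) (x : Fin (d + 1)) :
    MeasurableSet[𝓕 s] {ω | X s ω = x} :=
  hX.adapted s (measurableSet_singleton x)

lemma IsMarkovChain.measureReal_eq (hX : IsMarkovChain p μ 𝓕 X) (t : ι) (y : Fin (d + 1)) :
    μ.real {ω | X t ω = y} = p t 0 y := by
  have := hX.isProbabilityMeasure
  have h := hX.markov 0 t Set.univ MeasurableSet.univ 0 y
  have h1 : (Set.univ ∩ {ω | X 0 ω = 0} ∩ {ω | X (0 + t) ω = y} : Set Ω) =ᵐ[μ] ({ω | X t ω = y} : Set Ω) := by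
    filter_upwards [hX.start] with ω hω
    apply propext
    change (ω ∈ Set.univ ∩ {ω | X 0 ω = 0} ∩ {ω | X (0 + t) ω = y}) ↔ X t ω = y
    simp [hω]
  have h2 : (Set.univ ∩ {ω | X 0 ω = 0} : Set Ω) =ᵐ[μ] (Set.univ : Set Ω) := by
    filter_upwards [hX.start] with ω hω
    apply propext
    change (ω ∈ Set.univ ∩ {ω | X 0 ω = 0}) ↔ ω ∈ Set.univ
    simp [hω]
  rw [measureReal_congr h1, measureReal_congr h2] at h
  simpa using h

/-- Any strong stationary time is dominated by the likelihood ratio with respect to `π`. -/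
lemma measureReal_le_mul_le [OrderTopology ι] [CanonicallyOrderedAdd ι] (hp : IsStationarySemigroup p π)
    (hT : IsStrongStationaryTime p π μ X T)
    {q : ℕ → ι} (hq : ∀ s s', s < s' → ∃ n, s ≤ q n ∧ q n < s') (t : ι) (y : Fin (d + 1)) :
    μ.real {ω | T ω ≤ t} * π y ≤ p t 0 y := by
  obtain ⟨𝓕, hX, hst, -, hlaw, hind⟩ := hT
  have := hX.isProbabilityMeasure
  set E : Set Ω := {ω | T ω ≤ t} with hE
  set Y := stoppedValue X T with hY
  have hmeas := measurableSet_stoppedValue_inter hX.rightContinuous hX.adapted hst hq t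
  set A : ℕ → ι → Set Ω := fun N => gridCell T (grid q t N) with hA
  have hAm : ∀ N v, MeasurableSet (A N v) := fun N v =>
    𝓕.le v _ (measurableSet_gridCell hst _ v)
  have hAE : ∀ N, ∀ v ∈ grid q t N, A N v ⊆ E := fun N v hv ω h =>
    (mem_gridCell.1 h).1.trans (WithTop.coe_le_coe.2 (le_of_mem_grid hv))
  have hXm : ∀ v x, MeasurableSet {ω | X v ω = x} := fun v x =>
    𝓕.le v _ (hX.measurableSet_eq v x)
  have hAY : ∀ N, ∀ v ∈ grid q t N, ∀ x, MeasurableSet (A N v ∩ {ω | Y ω = x}) := by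
    intro N v hv x
    have : A N v ∩ {ω | Y ω = x} = A N v ∩ (E ∩ {ω | Y ω = x}) := by
      rw [← Set.inter_assoc, Set.inter_eq_left.2 (hAE N v hv)]
    rw [this]
    exact (hAm N v).inter (hmeas x)
  -- the part of the cell on which the grid approximation fails
  set B : ℕ → ι → Set Ω := fun N v => A N v ∩ {ω | X v ω ≠ Y ω} with hB
  have hBY : ∀ N, ∀ v ∈ grid q t N, ∀ x, MeasurableSet (B N v ∩ {ω | Y ω = x}) := by
    intro N v hv x
    have : B N v ∩ {ω | Y ω = x} = (A N v ∩ {ω | Y ω = x}) \ {ω | X v ω = x} := by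
      ext ω
      simp only [hB, Set.mem_inter_iff, Set.mem_ofPred_eq, Set.mem_sdiff]
      constructor
      · rintro ⟨⟨h1, h2⟩, h3⟩; exact ⟨⟨h1, h3⟩, fun h => h2 (h.trans h3.symm)⟩
      · rintro ⟨⟨h1, h3⟩, h2⟩; exact ⟨⟨h1, fun h => h2 (h.trans h3)⟩, h3⟩
    rw [this]
    exact (hAY N v hv x).diff (hXm v x)
  have hBm : ∀ N, ∀ v ∈ grid q t N, MeasurableSet (B N v) := by
    intro N v hv
    have : B N v = ⋃ x, B N v ∩ {ω | Y ω = x} := by ext; simp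
    rw [this]
    exact MeasurableSet.iUnion fun x => hBY N v hv x
  set bad : ℕ → Set Ω := fun N => ⋃ v ∈ grid q t N, B N v with hbad
  have hbadm : ∀ N, MeasurableSet (bad N) := fun N =>
    Finset.measurableSet_biUnion _ fun v hv => hBm N v hv
  -- Each `ω` lies in only finitely many of the sets `bad N`, by `eventually_gridCell_eq`.
  have hlim : Filter.Tendsto (fun N => μ.real (bad N)) Filter.atTop (nhds 0) := by
    have h1 : Filter.Tendsto (fun N => μ (bad N)) Filter.atTop (nhds (μ ∅)) := by
      refine tendsto_measure_of_tendsto_indicator _ hbadm MeasurableSet.univ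
        (measure_ne_top _ _) (Filter.Eventually.of_forall fun N => Set.subset_univ _) fun ω => ?_
      simp only [Set.mem_empty_iff_false, iff_false]
      by_cases hω : T ω ≤ t
      · refine (eventually_gridCell_eq hX.rightContinuous hq t ω hω).mono fun N hN hmem => ?_
        simp only [hbad, Set.mem_iUnion, exists_prop] at hmem
        obtain ⟨v, hv, h2, h3⟩ := hmem
        exact h3 (hN v hv h2)
      · refine Filter.Eventually.of_forall fun N hmem => hω ?_
        simp only [hbad, Set.mem_iUnion, exists_prop] at hmem
        obtain ⟨v, hv, h2, h3⟩ := hmem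
        exact hAE N v hv h2
    rw [measure_empty] at h1
    exact (ENNReal.tendsto_toReal ENNReal.zero_ne_top).comp h1
  have hbound : ∀ N, μ.real E * π y ≤ p t 0 y + μ.real (bad N) := by
    intro N
    have hr : ∀ v ∈ grid q t N, ∃ r, t = v + r := fun v hv =>
      exists_add_of_le (le_of_mem_grid hv)
    choose! r hr using hr
    have hEsum : μ.real E = ∑ v ∈ grid q t N, μ.real (A N v) := by
      rw [← measureReal_biUnion_finset (pairwiseDisjoint_gridCell _) fun v _ => hAm N v,
        biUnion_gridCell (mem_grid_self q t N) fun v hv => le_of_mem_grid hv]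
    -- On the cell of `v`, `X_T` has law `π` independently of the cell. If it were `X v`, running
    -- the chain for the remaining time `r v` would keep the law `π`; replacing `X_T` by `X v` costs
    -- at most the mass of `B N v`.
    have hcell : ∀ v ∈ grid q t N, μ.real (A N v) * π y ≤
        μ.real (A N v ∩ {ω | X t ω = y}) + μ.real (B N v) := by
      intro v hv
      have h1 : ∀ x, μ.real (A N v ∩ {ω | Y ω = x}) = μ.real (A N v) * π x := by
        intro x
        -- The cell is by definition the preimage under `T` of this set of times, so independence of
        -- `T` and `X_T` applies to it.
        have hs : MeasurableSet (Set.Iic (v : WithTop ι) \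
            ⋃ w ∈ (grid q t N).filter (· < v), Set.Iic (w : WithTop ι)) :=
          measurableSet_Iic.diff (Finset.measurableSet_biUnion _ fun w _ => measurableSet_Iic)
        have h2 := hind.measure_inter_preimage_eq_mul _ _ hs (measurableSet_singleton x)
        rw [← hlaw x, measureReal_def, measureReal_def, measureReal_def, ← ENNReal.toReal_mul]
        congr 1
      have h2 : ∑ x, π x * p (r v) x y = π y := congrFun (hp.stationary (r v)) y
      have h3 : ∑ x, μ.real (A N v ∩ {ω | X v ω = x}) * p (r v) x y =
          μ.real (A N v ∩ {ω | X t ω = y}) := by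
        rw [← sum_measureReal_inter_fiber (X v) (A N v ∩ {ω | X t ω = y}) fun x =>
          ((hAm N v).inter (hXm t y)).inter (hXm v x)]
        refine Finset.sum_congr rfl fun x _ => ?_
        rw [← hX.markov v (r v) _ (measurableSet_gridCell hst _ v) x y, ← hr v hv,
          Set.inter_right_comm]
      rw [← h2, Finset.mul_sum, ← h3,
        ← sum_measureReal_inter_fiber Y (B N v) (hBY N v hv), ← Finset.sum_add_distrib]
      refine Finset.sum_le_sum fun x _ => ?_
      rw [← mul_assoc, ← h1 x]
      have h4 : μ.real (A N v ∩ {ω | Y ω = x}) ≤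
          μ.real (A N v ∩ {ω | X v ω = x}) + μ.real (B N v ∩ {ω | Y ω = x}) := by
        refine (measureReal_mono ?_).trans (measureReal_union_le _ _)
        rintro ω ⟨h5, h6⟩
        by_cases h7 : X v ω = x
        · exact Or.inl ⟨h5, h7⟩
        · exact Or.inr ⟨⟨h5, fun h => h7 (h.trans h6)⟩, h6⟩
      have h8 := hp.le_one (r v) x y
      have h9 := hp.nonneg (r v) x y
      have h10 : 0 ≤ μ.real (B N v ∩ {ω | Y ω = x}) := measureReal_nonneg
      calc _ ≤ (μ.real (A N v ∩ {ω | X v ω = x}) + μ.real (B N v ∩ {ω | Y ω = x})) *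
            p (r v) x y := mul_le_mul_of_nonneg_right h4 h9
        _ ≤ _ := by nlinarith
    have h1 : ∑ v ∈ grid q t N, μ.real (A N v ∩ {ω | X t ω = y}) ≤ p t 0 y := by
      rw [← hX.measureReal_eq t y, ← measureReal_biUnion_finset]
      · exact measureReal_mono (Set.iUnion₂_subset fun v _ => Set.inter_subset_right)
      · exact (pairwiseDisjoint_gridCell _).mono fun v => Set.inter_subset_left
      · exact fun v _ => (hAm N v).inter (hXm t y)
    have h2 : ∑ v ∈ grid q t N, μ.real (B N v) = μ.real (bad N) := by
      rw [hbad, ← measureReal_biUnion_finset]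
      · exact (pairwiseDisjoint_gridCell _).mono fun v => Set.inter_subset_left
      · exact hBm N
    rw [hEsum, Finset.sum_mul]
    calc _ ≤ ∑ v ∈ grid q t N, (μ.real (A N v ∩ {ω | X t ω = y}) + μ.real (B N v)) :=
          Finset.sum_le_sum hcell
      _ ≤ _ := by rw [Finset.sum_add_distrib, h2]; linarith
  have h := ge_of_tendsto' (tendsto_const_nhds.add hlim) hbound
  simpa using h

end UpperBound

/-! ### Construction of strong stationary times on a sequence of epochs. -/

section Construction

variable {d : ℕ} {ι : Type} [LinearOrder ι] {Ω : Type u} {m : MeasurableSpace Ω} {μ : Measure Ω}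
  {p : ι → Matrix (Fin (d + 1)) (Fin (d + 1)) ℝ} {π : Fin (d + 1) → ℝ}
  {X : ι → Ω → Fin (d + 1)} {𝓕 : Filtration ι m}

/-- The index of the first of the decreasing events `N 1, N 2, …` that fails. -/
noncomputable def exitIndex (N : ℕ → Set Ω) (ω : Ω) : ℕ := sInf {k | ω ∉ N (k + 1)}

open Classical in
/-- The time on the grid `s` of the first failure of the decreasing events `N 1, N 2, …`. -/
noncomputable def exitTime (s : ℕ → ι) (N : ℕ → Set Ω) (ω : Ω) : WithTop ι :=
  if ∃ k, ω ∉ N (k + 1) then (s (exitIndex N ω) : WithTop ι) else ⊤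

lemma exitTime_le_iff {s : ℕ → ι} (hs : StrictMono s) {N : ℕ → Set Ω} {ω : Ω} {r : ι} :
    exitTime s N ω ≤ r ↔ ∃ k, s k ≤ r ∧ ω ∉ N (k + 1) := by
  unfold exitTime
  split_ifs with h
  · rw [WithTop.coe_le_coe]
    constructor
    · intro h1
      exact ⟨_, h1, Nat.sInf_mem (s := {k | ω ∉ N (k + 1)}) h⟩
    · rintro ⟨k, hk, h1⟩
      exact (hs.monotone (Nat.sInf_le h1)).trans hk
  · push Not at h
    simp only [top_le_iff, WithTop.coe_ne_top, false_iff, not_exists, not_and, not_not]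
    exact fun k _ => h k

/-- The hypothesis `hω` is needed because `sInf ∅ = 0`: where no event fails, the index would
wrongly be `0`. -/
lemma exitIndex_eq_iff {N : ℕ → Set Ω} (hN0 : N 0 = Set.univ) (hN : Antitone N) {ω : Ω}
    (hω : ∃ k, ω ∉ N (k + 1)) (k : ℕ) : exitIndex N ω = k ↔ ω ∈ N k \ N (k + 1) := by
  have hmem := Nat.sInf_mem (s := {k | ω ∉ N (k + 1)}) hω
  have hk : ∀ k, k ≤ exitIndex N ω → ω ∈ N k := by
    intro k hk
    cases k with
    | zero => rw [hN0]; trivial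
    | succ j =>
      by_contra h
      have : exitIndex N ω ≤ j := Nat.sInf_le h
      omega
  constructor
  · rintro rfl
    exact ⟨hk _ le_rfl, hmem⟩
  · rintro ⟨h1, h2⟩
    refine le_antisymm (Nat.sInf_le h2) ?_
    by_contra h
    exact hmem (hN (by change exitIndex N ω + 1 ≤ k; omega) h1)

/-- The conditional probability, given the path, of not having stopped before the `k`-th epoch,
when the chain is stopped with probability `ρ k y` at the `k`-th epoch in the state `y`. -/
noncomputable def survival {ι : Type} (ρ : ℕ → Fin (d + 1) → ℝ) (s : ℕ → ι)
    (X : ι → Ω → Fin (d + 1)) :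
    ℕ → Ω → ℝ
  | 0, _ => 1
  | k + 1, ω => survival ρ s X k ω * (1 - ρ k (X (s k) ω))

lemma survival_mem {ι : Type} {ρ : ℕ → Fin (d + 1) → ℝ} (hρ : ∀ k y, ρ k y ∈ Set.Icc (0 : ℝ) 1)
    (s : ℕ → ι) (X : ι → Ω → Fin (d + 1)) (k : ℕ) (ω : Ω) :
    survival ρ s X k ω ∈ Set.Icc (0 : ℝ) 1 := by
  induction k with
  | zero => simp [survival]
  | succ k ih =>
    have h := hρ k (X (s k) ω)
    rw [survival]
    exact ⟨mul_nonneg ih.1 (by linarith [h.2]), mul_le_one₀ ih.2 (by linarith [h.2])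
      (by linarith [h.1])⟩

lemma survival_succ_le {ι : Type} {ρ : ℕ → Fin (d + 1) → ℝ} (hρ : ∀ k y, ρ k y ∈ Set.Icc (0 : ℝ) 1)
    (s : ℕ → ι) (X : ι → Ω → Fin (d + 1)) (k : ℕ) (ω : Ω) :
    survival ρ s X (k + 1) ω ≤ survival ρ s X k ω := by
  have h := hρ k (X (s k) ω)
  rw [survival]
  exact mul_le_of_le_one_right (survival_mem hρ s X k ω).1 (by linarith [h.1])

lemma measurable_survival (hX : ∀ t, Measurable[𝓕 t] (X t)) (ρ : ℕ → Fin (d + 1) → ℝ)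
    {s : ℕ → ι} (hs : StrictMono s) (k : ℕ) :
    Measurable[𝓕 (s k)] (survival ρ s X (k + 1)) := by
  have hρ : ∀ k, Measurable[𝓕 (s k)] fun ω => 1 - ρ k (X (s k) ω) := fun k =>
    (measurable_of_countable fun y => 1 - ρ k y).comp (hX (s k))
  induction k with
  | zero =>
    have : survival ρ s X 1 = fun ω => 1 * (1 - ρ 0 (X (s 0) ω)) := rfl
    rw [this]
    simpa using hρ 0
  | succ k ih =>
    have ih' : Measurable[𝓕 (s (k + 1))] (survival ρ s X (k + 1)) :=
      ih.mono (𝓕.mono (hs.monotone k.le_succ)) le_rfl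
    exact ih'.mul (hρ (k + 1))

variable [AddCommMonoid ι] [TopologicalSpace ι]

/-- Stopping at the first failure of a decreasing sequence of events is a strong stationary time as
soon as the state at each stopping epoch has law `π`. -/
lemma isStrongStationaryTime_exitTime [OrderTopology ι] (hX : IsMarkovChain p μ 𝓕 X) (hπ0 : ∀ y, 0 ≤ π y)
    (hπ1 : ∑ y, π y = 1) {s : ℕ → ι} (hs : StrictMono s) {N : ℕ → Set Ω}
    (hN0 : N 0 = Set.univ) (hN : Antitone N) (hNm : ∀ k, MeasurableSet[𝓕 (s k)] (N (k + 1)))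
    {c : ℕ → ℝ} (hc0 : ∀ k, 0 ≤ c k) (hc1 : HasSum c 1)
    (hc : ∀ k y, μ.real ((N k \ N (k + 1)) ∩ {ω | X (s k) ω = y}) = c k * π y) :
    IsStrongStationaryTime p π μ X (exitTime s N) := by
  have := hX.isProbabilityMeasure
  have hNm' : ∀ k, MeasurableSet (N k) := by
    intro k
    cases k with
    | zero => rw [hN0]; exact MeasurableSet.univ
    | succ k => exact 𝓕.le _ _ (hNm k)
  have hXm : ∀ v x, MeasurableSet {ω | X v ω = x} := fun v x =>
    𝓕.le v _ (hX.measurableSet_eq v x)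
  have hdiff : ∀ k, MeasurableSet (N k \ N (k + 1)) := fun k => (hNm' k).diff (hNm' (k + 1))
  have hck : ∀ k, μ.real (N k \ N (k + 1)) = c k := by
    intro k
    rw [← sum_measureReal_inter_fiber (X (s k)) _ fun x => (hdiff k).inter (hXm _ x)]
    simp_rw [hc, ← Finset.mul_sum, hπ1, mul_one]
  have hdisj : Pairwise (Function.onFun Disjoint fun k => N k \ N (k + 1)) := by
    intro j k hjk
    rw [Function.onFun, Set.disjoint_left]
    rintro ω ⟨h1, h2⟩ ⟨h3, h4⟩
    rcases lt_or_gt_of_ne hjk with h | h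
    · exact h2 (hN (Nat.succ_le_of_lt h) h3)
    · exact h4 (hN (Nat.succ_le_of_lt h) h1)
  -- The disjoint differences have total mass `∑ c k = 1`, so almost surely some event fails.
  have hfin : ∀ᵐ ω ∂μ, ∃ k, ω ∉ N (k + 1) := by
    have h1 : μ (⋃ k, N k \ N (k + 1)) = 1 := by
      rw [measure_iUnion hdisj hdiff]
      have : ∀ k, μ (N k \ N (k + 1)) = ENNReal.ofReal (c k) := fun k => by
        rw [← hck k, ofReal_measureReal]
      simp_rw [this]
      rw [← ENNReal.ofReal_tsum_of_nonneg hc0 hc1.summable, hc1.tsum_eq, ENNReal.ofReal_one]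
    have h2 := (prob_compl_eq_zero_iff (MeasurableSet.iUnion hdiff)).2 h1
    filter_upwards [compl_mem_ae_iff.2 h2] with ω hω
    rw [compl_compl, Set.mem_iUnion] at hω
    obtain ⟨k, hk⟩ := hω
    exact ⟨k, hk.2⟩
  set K := exitIndex N with hK
  set Y : Ω → Fin (d + 1) := fun ω => X (s (K ω)) ω with hY
  have hKm : Measurable K := by
    refine measurable_to_countable' fun k => ?_
    -- The second set collects the points where no event fails; there `K` takes the default value
    -- `0`.
    have : K ⁻¹' {k} = (N k \ N (k + 1)) ∪ ((⋂ j, N (j + 1)) ∩ {_ω | 0 = k}) := by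
      ext ω
      by_cases hω : ∃ k, ω ∉ N (k + 1)
      · have h1 : ω ∉ ⋂ j, N (j + 1) := by simpa using hω
        rw [Set.mem_preimage, Set.mem_singleton_iff, exitIndex_eq_iff hN0 hN hω k]
        simp [h1]
      · push Not at hω
        have h2 : {k | ω ∉ N (k + 1)} = ∅ := by ext k; simp [hω k]
        have h1 : K ω = 0 := by rw [hK, exitIndex, h2, Nat.sInf_empty]
        simp [h1, hω]
    rw [this]
    exact (hdiff k).union ((MeasurableSet.iInter fun j => hNm' _).inter (MeasurableSet.const _))
  have hYm : Measurable Y := by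
    refine measurable_to_countable' fun y => ?_
    have : Y ⁻¹' {y} = ⋃ k, K ⁻¹' {k} ∩ {ω | X (s k) ω = y} := by
      ext ω; simp [hY]
    rw [this]
    exact MeasurableSet.iUnion fun k => (hKm (measurableSet_singleton k)).inter (hXm _ _)
  have hKY : ∀ k y, μ (K ⁻¹' {k} ∩ Y ⁻¹' {y}) = ENNReal.ofReal (c k * π y) := by
    intro k y
    rw [← hc k y, ofReal_measureReal]
    apply measure_congr
    filter_upwards [hfin] with ω hω
    apply propext
    change (K ω = k ∧ X (s (K ω)) ω = y) ↔ (ω ∈ N k \ N (k + 1) ∧ X (s k) ω = y)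
    rw [← exitIndex_eq_iff hN0 hN hω k]
    constructor
    · rintro ⟨rfl, h⟩; exact ⟨rfl, h⟩
    · rintro ⟨h1, h⟩; subst h1; exact ⟨rfl, h⟩
  have hKk : ∀ k, μ (K ⁻¹' {k}) = ENNReal.ofReal (c k) := by
    intro k
    rw [← hck k, ofReal_measureReal]
    apply measure_congr
    filter_upwards [hfin] with ω hω
    exact propext (exitIndex_eq_iff hN0 hN hω k)
  have hYy : ∀ y, μ (Y ⁻¹' {y}) = ENNReal.ofReal (π y) := by
    intro y
    have h1 : Y ⁻¹' {y} = ⋃ k, K ⁻¹' {k} ∩ Y ⁻¹' {y} := by ext ω; simp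
    rw [h1, measure_iUnion]
    · simp_rw [hKY]
      have h2 := hc1.mul_right (π y)
      rw [← ENNReal.ofReal_tsum_of_nonneg (fun k => mul_nonneg (hc0 k) (hπ0 y)) h2.summable,
        h2.tsum_eq, one_mul]
    · intro j k hjk
      rw [Function.onFun, Set.disjoint_left]
      rintro ω ⟨h2, _⟩ ⟨h3, _⟩
      exact hjk (h2.symm.trans h3)
    · exact fun k => (hKm (measurableSet_singleton k)).inter (hYm (measurableSet_singleton y))
  have hTK : (fun ω => (s (K ω) : WithTop ι)) =ᵐ[μ] exitTime s N := by
    filter_upwards [hfin] with ω hω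
    simp [exitTime, hω, hK]
  have hYT : Y =ᵐ[μ] stoppedValue X (exitTime s N) := by
    filter_upwards [hTK] with ω hω
    rw [stoppedValue, ← hω]
    rfl
  refine ⟨𝓕, hX, fun r => ?_, ?_, fun y => ?_, ?_⟩
  · have : {ω | exitTime s N ω ≤ r} = ⋃ k ∈ {k | s k ≤ r}, (N (k + 1))ᶜ := by
      ext ω
      simp [exitTime_le_iff hs]
    rw [this]
    exact MeasurableSet.biUnion (Set.to_countable _) fun k hk => 𝓕.mono hk _ (hNm k).compl
  · filter_upwards [hTK] with ω hω
    rw [← hω]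
    exact WithTop.coe_ne_top
  · have h1 : ({ω | stoppedValue X (exitTime s N) ω = y} : Set Ω) =ᵐ[μ] Y ⁻¹' {y} := by
      filter_upwards [hYT] with ω hω
      apply propext
      change stoppedValue X (exitTime s N) ω = y ↔ Y ω = y
      rw [hω]
    rw [measureReal_congr h1, measureReal_def, hYy, ENNReal.toReal_ofReal (hπ0 y)]
  · have hind : IndepFun K Y μ := by
      rw [indepFun_iff_map_prod_eq_prod_map_map hKm.aemeasurable hYm.aemeasurable]
      refine Measure.ext_of_singleton fun ⟨k, y⟩ => ?_
      rw [← Set.singleton_prod_singleton, Measure.prod_prod, Measure.map_apply hKm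
        (measurableSet_singleton _), Measure.map_apply hYm (measurableSet_singleton _),
        Measure.map_apply (hKm.prodMk hYm) ((measurableSet_singleton _).prod
        (measurableSet_singleton _)), Set.mk_preimage_prod, hKY, hKk, hYy,
        ENNReal.ofReal_mul (hc0 k)]
    exact (hind.comp (φ := fun k => (s k : WithTop ι)) (ψ := id) (measurable_of_countable _)
      measurable_id).congr hTK hYT

/-- The filtration `𝓕` enlarged by an independent uniform variable known from the start. -/
def extendFiltration (𝓕 : Filtration ι m) :
    Filtration ι (inferInstance : MeasurableSpace (Ω × unitInterval)) where
  seq s := (𝓕 s).prod inferInstance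
  mono' _ _ hst := sup_le_sup (MeasurableSpace.comap_mono (𝓕.mono hst)) le_rfl
  le' s := sup_le_sup (MeasurableSpace.comap_mono (𝓕.le s)) le_rfl

/-- For a fixed value of the uniform variable, the section of an event of the enlarged filtration
lies in `𝓕 s`, so the Markov property holds section by section and can be integrated. -/
lemma IsMarkovChain.extend (hX : IsMarkovChain p μ 𝓕 X) (hp : ∀ t x y, 0 ≤ p t x y) :
    IsMarkovChain p (μ.prod (volume : Measure unitInterval)) (extendFiltration 𝓕)
      (fun t ω => X t ω.1) := by
  have := hX.isProbabilityMeasure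
  refine ⟨inferInstance, fun t => ?_, ?_, fun s t A hA x y => ?_, fun ω t => hX.rightContinuous _ t⟩
  · exact (hX.adapted t).comp (@measurable_fst _ _ (𝓕 t) _)
  · exact Measure.quasiMeasurePreserving_fst.ae hX.start
  · have hA' : MeasurableSet A := (extendFiltration 𝓕).le s _ hA
    have hm : ∀ v x, MeasurableSet {ω : Ω × unitInterval | X v ω.1 = x} := fun v x =>
      measurable_fst (𝓕.le v _ (hX.measurableSet_eq v x))
    rw [measureReal_def, measureReal_def, Measure.prod_apply_symm
      ((hA'.inter (hm s x)).inter (hm (s + t) y)), Measure.prod_apply_symm (hA'.inter (hm s x))]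
    have hsec : ∀ u : unitInterval, μ ((fun ω => (ω, u)) ⁻¹' (A ∩ {ω | X s ω.1 = x} ∩
        {ω | X (s + t) ω.1 = y})) =
        μ ((fun ω => (ω, u)) ⁻¹' (A ∩ {ω | X s ω.1 = x})) * ENNReal.ofReal (p t x y) := by
      intro u
      have hAu : MeasurableSet[𝓕 s] ((fun ω => (ω, u)) ⁻¹' A) :=
        (@measurable_prodMk_right _ _ (𝓕 s) _ u) hA
      have h := hX.markov s t _ hAu x y
      rw [← ofReal_measureReal, ← ofReal_measureReal (s := (fun ω => (ω, u)) ⁻¹' (A ∩ _)),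
        ← ENNReal.ofReal_mul measureReal_nonneg]
      exact congrArg ENNReal.ofReal h
    simp_rw [hsec]
    rw [lintegral_mul_const' _ _ ENNReal.ofReal_ne_top, ENNReal.toReal_mul,
      ENNReal.toReal_ofReal (hp t x y)]

/-- Given the path, a uniform variable is at most `W` with probability `W`. A single uniform
variable thus realises all the survival probabilities at once, through nested events. -/
lemma prod_measure_le_inter {W : Ω → ℝ} (hW : Measurable W) (hW0 : ∀ ω, 0 ≤ W ω)
    (hW1 : ∀ ω, W ω ≤ 1) {B : Set Ω} (hB : MeasurableSet B) :
    (μ.prod (volume : Measure unitInterval))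
      ({ω : Ω × unitInterval | (ω.2 : ℝ) ≤ W ω.1} ∩ {ω | ω.1 ∈ B}) =
      ∫⁻ ω in B, ENNReal.ofReal (W ω) ∂μ := by
  have hm : MeasurableSet ({ω : Ω × unitInterval | (ω.2 : ℝ) ≤ W ω.1} ∩ {ω | ω.1 ∈ B}) :=
    (measurableSet_le (measurable_subtype_coe.comp measurable_snd)
      (hW.comp measurable_fst)).inter (measurable_fst hB)
  rw [Measure.prod_apply hm, ← lintegral_indicator hB]
  refine lintegral_congr fun ω => ?_
  by_cases hω : ω ∈ B
  · rw [Set.indicator_of_mem hω]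
    have : Prod.mk ω ⁻¹' ({ω : Ω × unitInterval | (ω.2 : ℝ) ≤ W ω.1} ∩ {ω | ω.1 ∈ B}) =
        Set.Iic (⟨W ω, hW0 ω, hW1 ω⟩ : unitInterval) := by
      ext u
      simp [hω, ← Subtype.coe_le_coe]
    rw [this, unitInterval.volume_Iic]
  · rw [Set.indicator_of_notMem hω]
    have : Prod.mk ω ⁻¹' ({ω : Ω × unitInterval | (ω.2 : ℝ) ≤ W ω.1} ∩ {ω | ω.1 ∈ B}) = ∅ := by
      ext u
      simp [hω]
    rw [this, measure_empty]

/-- For every increasing sequence of epochs `s`, there is a strong stationary time with values in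
this sequence that has stopped by the first epoch with the largest possible probability. -/
lemma exists_isStrongStationaryTime [OrderTopology ι] [CanonicallyOrderedAdd ι] (hp : IsStationarySemigroup p π)
    (hX : IsMarkovChain p μ 𝓕 X) {s : ℕ → ι} (hs : StrictMono s)
    (hlim : Filter.Tendsto (fun k => p (s k) 0 (Fin.last d) / π (Fin.last d)) Filter.atTop
      (nhds 1)) :
    ∃ T : Ω × unitInterval → WithTop ι,
      IsStrongStationaryTime p π (μ.prod (volume : Measure unitInterval)) (fun t ω => X t ω.1) T ∧
      p (s 0) 0 (Fin.last d) / π (Fin.last d) ≤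
        (μ.prod (volume : Measure unitInterval)).real {ω | T ω ≤ s 0} := by
  have := hX.isProbabilityMeasure
  set μ' := μ.prod (volume : Measure unitInterval) with hμ'
  have hX' := hX.extend hp.nonneg
  set X' : ι → Ω × unitInterval → Fin (d + 1) := fun t ω => X t ω.1 with hX'def
  -- `b k` is the intended probability of having stopped before the `k`-th epoch, whence the shift:
  -- `b 0 = 0`, and `b (k + 1)` is the ratio at `s k`.
  set b : ℕ → ℝ := fun k => Nat.casesOn k 0 fun j => p (s j) 0 (Fin.last d) / π (Fin.last d)
    with hb
  have hb0 : b 0 = 0 := rfl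
  have hbs : ∀ k, b (k + 1) = p (s k) 0 (Fin.last d) / π (Fin.last d) := fun _ => rfl
  have hπd := hp.pos (Fin.last d)
  have hble : ∀ k y, b (k + 1) * π y ≤ p (s k) 0 y := by
    intro k y
    rw [hbs, div_mul_eq_mul_div, div_le_iff₀ hπd]
    exact hp.corner_le (s k) y
  have hstep : ∀ k, ∃ r, s (k + 1) = s k + r := fun k =>
    exists_add_of_le (hs.monotone k.le_succ)
  choose r hr using hstep
  have hprop : ∀ k y, p (s (k + 1)) 0 y = ∑ x, p (s k) 0 x * p (r k) x y := by
    intro k y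
    rw [hr, hp.add, Matrix.mul_apply]
  have hstat : ∀ k y, ∑ x, π x * p (r k) x y = π y := fun k y =>
    congrFun (hp.stationary (r k)) y
  -- The bound `b (k + 1) * π ≤ p (s k) 0` is preserved by a further transition, because `π` is
  -- stationary; its last coordinate compares the consecutive values.
  have hbmono : ∀ k, b k ≤ b (k + 1) := by
    intro k
    cases k with
    | zero => rw [hb0, hbs]; exact div_nonneg (hp.nonneg _ _ _) hπd.le
    | succ k =>
      rw [hbs (k + 1), le_div_iff₀ hπd, hprop, ← hstat k (Fin.last d), Finset.mul_sum]
      refine Finset.sum_le_sum fun x _ => ?_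
      rw [← mul_assoc]
      exact mul_le_mul_of_nonneg_right (hble k x) (hp.nonneg _ _ _)
  -- At epoch `k` the unstopped mass in `y` is `p (s k) 0 y - b k * π y`, and the part to be stopped
  -- is `(b (k + 1) - b k) * π y`; `ρ` is their quotient. If the denominator vanishes, so does the
  -- numerator, and the value `0` of the quotient is harmless.
  set ρ : ℕ → Fin (d + 1) → ℝ := fun k y =>
    (b (k + 1) - b k) * π y / (p (s k) 0 y - b k * π y) with hρdef
  have hnum : ∀ k y, 0 ≤ (b (k + 1) - b k) * π y := fun k y =>
    mul_nonneg (sub_nonneg.2 (hbmono k)) (hp.pos y).le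
  have hnd : ∀ k y, (b (k + 1) - b k) * π y ≤ p (s k) 0 y - b k * π y := fun k y => by
    linarith [hble k y]
  have hρ : ∀ k y, ρ k y ∈ Set.Icc (0 : ℝ) 1 := fun k y =>
    ⟨div_nonneg (hnum k y) ((hnum k y).trans (hnd k y)),
      div_le_one_of_le₀ (hnd k y) ((hnum k y).trans (hnd k y))⟩
  have hρmul : ∀ k y, (1 - ρ k y) * (p (s k) 0 y - b k * π y) =
      p (s k) 0 y - b (k + 1) * π y := by
    intro k y
    by_cases h0 : p (s k) 0 y - b k * π y = 0
    · have h1 := hnd k y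
      rw [h0] at h1
      have h2 := le_antisymm h1 (hnum k y)
      rw [h0]
      linarith
    · rw [sub_mul, hρdef, div_mul_cancel₀ _ h0]
      ring
  set W := survival ρ s X with hW
  have hWm : ∀ k, Measurable (W k) := by
    intro k
    cases k with
    | zero => exact measurable_const
    | succ k => exact (measurable_survival hX.adapted ρ hs k).mono (𝓕.le _) le_rfl
  set N : ℕ → Set (Ω × unitInterval) := fun k => {ω | (ω.2 : ℝ) ≤ W k ω.1} with hN
  have hN0 : N 0 = Set.univ := by
    ext ω
    simpa [hN, hW, survival] using ω.2.2.2
  have hNanti : Antitone N := antitone_nat_of_succ_le fun k ω hω =>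
    le_trans hω (survival_succ_le hρ s X k ω.1)
  have hNm : ∀ k, MeasurableSet[extendFiltration 𝓕 (s k)] (N (k + 1)) := by
    intro k
    have h1 : Measurable[extendFiltration 𝓕 (s k)] fun ω : Ω × unitInterval => W (k + 1) ω.1 :=
      (measurable_survival hX.adapted ρ hs k).comp (@measurable_fst _ _ (𝓕 (s k)) _)
    have h2 : Measurable[extendFiltration 𝓕 (s k)] fun ω : Ω × unitInterval => (ω.2 : ℝ) :=
      measurable_subtype_coe.comp (@measurable_snd _ _ (𝓕 (s k)) _)
    exact measurableSet_le h2 h1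
  have hNm' : ∀ k, MeasurableSet (N k) := fun k =>
    measurableSet_le (measurable_subtype_coe.comp measurable_snd) ((hWm k).comp measurable_fst)
  have hXm : ∀ v x, MeasurableSet {ω | X v ω = x} := fun v x =>
    𝓕.le v _ (hX.measurableSet_eq v x)
  have hXm' : ∀ v x, MeasurableSet {ω | X' v ω = x} := fun v x =>
    measurable_fst (hXm v x)
  have hthin : ∀ k x, μ'.real (N (k + 1) ∩ {ω | X' (s k) ω = x}) =
      (1 - ρ k x) * μ'.real (N k ∩ {ω | X' (s k) ω = x}) := by
    intro k x
    have h0 : 0 ≤ 1 - ρ k x := by linarith [(hρ k x).2]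
    have h1 : μ' (N (k + 1) ∩ {ω | X' (s k) ω = x}) =
        ENNReal.ofReal (1 - ρ k x) * μ' (N k ∩ {ω | X' (s k) ω = x}) := by
      have h2 := fun k' => prod_measure_le_inter (μ := μ) (hWm k')
        (fun ω => (survival_mem hρ s X k' ω).1) (fun ω => (survival_mem hρ s X k' ω).2)
        (hXm (s k) x)
      refine (h2 (k + 1)).trans (Eq.trans ?_ (congrArg _ (h2 k).symm))
      rw [← lintegral_const_mul' _ _ ENNReal.ofReal_ne_top]
      refine setLIntegral_congr_fun (hXm (s k) x) fun ω hω => ?_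
      have hω : X (s k) ω = x := hω
      simp only [hW, survival, hω]
      rw [mul_comm, ENNReal.ofReal_mul h0]
    rw [measureReal_def, h1, ENNReal.toReal_mul, ENNReal.toReal_ofReal h0, measureReal_def]
  -- Thinning at `s k` removes a multiple of `π`; the transition to `s (k + 1)` fixes `π`, so the
  -- form of the unstopped mass persists.
  have hmass : ∀ k y, μ'.real (N k ∩ {ω | X' (s k) ω = y}) = p (s k) 0 y - b k * π y := by
    intro k
    induction k with
    | zero =>
      intro y
      rw [hN0, Set.univ_inter, hX'.measureReal_eq, hb0]
      ring
    | succ k ih =>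
      intro y
      rw [← sum_measureReal_inter_fiber (X' (s k)) _ fun x =>
        ((hNm' (k + 1)).inter (hXm' (s (k + 1)) y)).inter (hXm' (s k) x), hprop, ← hstat k y,
        Finset.mul_sum, ← Finset.sum_sub_distrib]
      refine Finset.sum_congr rfl fun x _ => ?_
      rw [Set.inter_right_comm, hr k, hX'.markov (s k) (r k) _ (hNm k) x y, hthin, ih, hρmul]
      ring
  have hmass' : ∀ k y, μ'.real (N (k + 1) ∩ {ω | X' (s k) ω = y}) =
      p (s k) 0 y - b (k + 1) * π y := by
    intro k y
    rw [hthin, hmass, hρmul]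
  have hsum : HasSum (fun k => b (k + 1) - b k) 1 := by
    rw [hasSum_iff_tendsto_nat_of_nonneg fun k => sub_nonneg.2 (hbmono k)]
    simp_rw [Finset.sum_range_sub, hb0, sub_zero]
    exact (Filter.tendsto_add_atTop_iff_nat 1).1 hlim
  refine ⟨exitTime s N, isStrongStationaryTime_exitTime hX' (fun y => (hp.pos y).le)
    hp.sum_eq_one hs hN0 hNanti hNm (fun k => sub_nonneg.2 (hbmono k)) hsum fun k y => ?_, ?_⟩
  · rw [Set.inter_sdiff_distrib_right, measureReal_sdiff
      (Set.inter_subset_inter_left _ (hNanti k.le_succ)) ((hNm' _).inter (hXm' _ _)),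
      hmass, hmass']
    ring
  · have h1 : μ'.real (N 1) = 1 - p (s 0) 0 (Fin.last d) / π (Fin.last d) := by
      rw [← sum_measureReal_inter_fiber (X' (s 0)) _ fun x => (hNm' 1).inter (hXm' (s 0) x)]
      simp_rw [hmass' 0]
      rw [Finset.sum_sub_distrib, ← Finset.mul_sum, hp.row_sum, hp.sum_eq_one, mul_one]
    have h2 : μ'.real (N 1)ᶜ = p (s 0) 0 (Fin.last d) / π (Fin.last d) := by
      rw [probReal_compl_eq_one_sub (hNm' 1), h1]; ring
    rw [← h2]
    refine measureReal_mono fun ω hω => ?_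
    exact (exitTime_le_iff hs).2 ⟨0, le_rfl, hω⟩

end Construction

/-! ### The distribution function of a fastest strong stationary time. -/

section Fastest

variable {d : ℕ} {ι : Type} [LinearOrder ι] [AddCommMonoid ι] [CanonicallyOrderedAdd ι]
  [TopologicalSpace ι] [OrderTopology ι]
  {Ω : Type u} {m : MeasurableSpace Ω} {μ : Measure Ω}
  {p : ι → Matrix (Fin (d + 1)) (Fin (d + 1)) ℝ} {π : Fin (d + 1) → ℝ}
  {X : ι → Ω → Fin (d + 1)} {T : Ω → WithTop ι}

/-- The distribution function of a fastest strong stationary time. -/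
lemma measureReal_fastest_le (hp : IsStationarySemigroup p π)
    (hT : IsFastestStrongStationaryTime p π μ X T)
    {q : ℕ → ι} (hq : ∀ s s', s < s' → ∃ n, s ≤ q n ∧ q n < s')
    {s : ℕ → ι} (hs : StrictMono s) (hcof : ∀ r, ∃ k, r ≤ s k) :
    μ.real {ω | T ω ≤ s 0} = p (s 0) 0 (Fin.last d) / π (Fin.last d) := by
  obtain ⟨hSST, hfast⟩ := hT
  have hπd := hp.pos (Fin.last d)
  have hle : ∀ t : ι, μ.real {ω | T ω ≤ t} ≤ p t 0 (Fin.last d) / π (Fin.last d) := fun t =>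
    (le_div_iff₀ hπd).2 (measureReal_le_mul_le hp hSST hq t _)
  obtain ⟨𝓕, hX, -, hfin, -, -⟩ := hSST
  have := hX.isProbabilityMeasure
  have hle1 : ∀ t : ι, p t 0 (Fin.last d) / π (Fin.last d) ≤ 1 := by
    intro t
    have h : ∀ y ∈ Finset.univ, p t 0 (Fin.last d) / π (Fin.last d) * π y ≤ p t 0 y := by
      intro y _
      rw [div_mul_eq_mul_div, div_le_iff₀ hπd]
      exact hp.corner_le t y
    have h2 := Finset.sum_le_sum h
    rwa [← Finset.mul_sum, hp.sum_eq_one, hp.row_sum, mul_one] at h2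
  have hmono : Monotone fun k => {ω | T ω ≤ s k} := fun j k hjk ω hω =>
    le_trans hω (WithTop.coe_le_coe.2 (hs.monotone hjk))
  -- The almost sure finiteness of the given `T` forces the ratios, squeezed between `P(T ≤ s k)`
  -- and `1`, to tend to `1`. This replaces a convergence theorem for the chain.
  have htend : Filter.Tendsto (fun k => μ.real {ω | T ω ≤ s k}) Filter.atTop (nhds 1) := by
    have h1 : μ (⋃ k, {ω | T ω ≤ s k}) = 1 := by
      have h3 : (⋃ k, {ω | T ω ≤ s k} : Set Ω) =ᵐ[μ] (Set.univ : Set Ω) := by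
        filter_upwards [hfin] with ω hω
        apply propext
        change (ω ∈ ⋃ k, {ω | T ω ≤ s k}) ↔ True
        obtain ⟨r, hr⟩ := WithTop.ne_top_iff_exists.1 hω
        obtain ⟨k, hk⟩ := hcof r
        rw [iff_true, Set.mem_iUnion]
        exact ⟨k, hr.symm.le.trans (WithTop.coe_le_coe.2 hk)⟩
      rw [measure_congr h3, measure_univ]
    have h2 := tendsto_measure_iUnion_atTop (μ := μ) hmono
    rw [h1] at h2
    exact (ENNReal.tendsto_toReal ENNReal.one_ne_top).comp h2
  have hlim : Filter.Tendsto (fun k => p (s k) 0 (Fin.last d) / π (Fin.last d)) Filter.atTop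
      (nhds 1) :=
    tendsto_of_tendsto_of_tendsto_of_le_of_le htend tendsto_const_nhds (fun k => hle _)
      fun k => hle1 _
  -- The competitor depends on the epochs `s`, but only its value at `s 0` is compared with `T`.
  obtain ⟨T', hT', hge⟩ := exists_isStrongStationaryTime hp hX hs hlim
  refine le_antisymm (hle _) (hge.trans ?_)
  exact ENNReal.toReal_mono (measure_ne_top _ _) (hfast _ _ _ _ T' hT' (s 0))

end Fastest

/-! ### Generating functions and the discrete resolvent. -/

section Discrete

variable {Ω : Type u} {m : MeasurableSpace Ω} {μ : Measure Ω}

/-- Integrate `∑ n ≥ τ, z ^ n = z ^ τ / (1 - z)` term by term. -/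
lemma integral_pow_eq_tsum [IsProbabilityMeasure μ] {τ : Ω → ℕ} (hτ : Measurable τ) {z : ℂ}
    (hz : ‖z‖ < 1) :
    ∫ ω, z ^ τ ω ∂μ = (1 - z) * ∑' n : ℕ, z ^ n * (μ.real {ω | τ ω ≤ n} : ℂ) := by
  have hz1 : 1 - z ≠ 0 := by
    intro h
    rw [sub_eq_zero] at h
    rw [← h] at hz
    simp at hz
  set F : ℕ → Ω → ℂ := fun n => {ω | τ ω ≤ n}.indicator fun _ => z ^ n with hF
  have hm : ∀ n, MeasurableSet {ω | τ ω ≤ n} := fun n => hτ measurableSet_Iic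
  have h1 : ∀ ω, ∑' n, F n ω = z ^ τ ω / (1 - z) := by
    intro ω
    have h2 : HasSum (fun n => F (n + τ ω) ω) (z ^ τ ω * (1 - z)⁻¹) := by
      have h3 := (hasSum_geometric_of_norm_lt_one hz).mul_left (z ^ τ ω)
      have h4 : (fun n => F (n + τ ω) ω) = fun n => z ^ τ ω * z ^ n := by
        ext n
        simp [hF, pow_add, mul_comm]
      rwa [h4]
    have h4 := (hasSum_nat_add_iff (f := fun n => F n ω) (τ ω)).1 h2
    have h5 : ∑ i ∈ Finset.range (τ ω), F i ω = 0 := by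
      refine Finset.sum_eq_zero fun i hi => ?_
      simp only [hF]
      apply Set.indicator_of_notMem
      simpa using hi
    rw [h5, add_zero] at h4
    rw [h4.tsum_eq, div_eq_mul_inv]
  have hInt : ∀ n, ∫ ω, F n ω ∂μ = z ^ n * (μ.real {ω | τ ω ≤ n} : ℂ) := by
    intro n
    simp only [hF]
    rw [integral_indicator_const _ (hm n), Complex.real_smul, mul_comm]
  have hsum := hasSum_integral_of_summable_integral_norm (μ := μ) (F := F)
    (fun n => (integrable_const _).indicator (hm n)) (by
      refine Summable.of_nonneg_of_le (fun n => integral_nonneg fun ω => norm_nonneg _)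
        (fun n => ?_) (summable_geometric_of_lt_one (norm_nonneg z) hz)
      calc ∫ ω, ‖F n ω‖ ∂μ ≤ ∫ _ω, ‖z‖ ^ n ∂μ := by
            refine integral_mono_of_nonneg (Filter.Eventually.of_forall fun ω => norm_nonneg _)
              (integrable_const _) (Filter.Eventually.of_forall fun ω => ?_)
            exact (norm_indicator_le_norm_self _ _).trans (norm_pow _ _).le
        _ = ‖z‖ ^ n := by simp)
  have h6 := hsum.tsum_eq
  simp_rw [hInt, h1] at h6
  rw [h6, integral_div]
  field_simp

open Matrix in
/-- The generating function of the corner entries of the powers of a skip-free matrix. -/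
lemma tsum_corner_mul_det {d : ℕ} {P : Matrix (Fin (d + 1)) (Fin (d + 1)) ℝ}
    (hP : ∀ (n : ℕ) x y, (P ^ n) x y ∈ Set.Icc (0 : ℝ) 1) (hskip : IsSkipFree P) {z : ℂ}
    (hz : ‖z‖ < 1) (hz0 : z ≠ 0) :
    (∑' n : ℕ, z ^ n * ((P ^ n) 0 (Fin.last d) : ℂ)) *
      (scalar (Fin (d + 1)) (z⁻¹ - 1) - (P - 1).map (fun x : ℝ => (x : ℂ))).det =
      z⁻¹ * ∏ i : Fin d, ((P i.castSucc i.succ : ℝ) : ℂ) := by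
  set A := (P - 1).map (fun x : ℝ => (x : ℂ)) with hA
  have hne : ∀ i j, i ≠ j → A i j = (P i j : ℂ) := by
    intro i j hij
    simp [hA, Matrix.one_apply_ne hij]
  set L : Fin (d + 1) → ℂ := fun x => ∑' n : ℕ, z ^ n * ((P ^ n) 0 x : ℂ) with hL
  have hsum : ∀ x, Summable fun n : ℕ => z ^ n * ((P ^ n) 0 x : ℂ) := by
    intro x
    refine Summable.of_norm_bounded (summable_geometric_of_lt_one (norm_nonneg z) hz) fun n => ?_
    rw [norm_mul, norm_pow, Complex.norm_real, Real.norm_of_nonneg (hP n 0 x).1]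
    exact mul_le_of_le_one_right (by positivity) (hP n 0 x).2
  have hB : scalar (Fin (d + 1)) (z⁻¹ - 1) - A =
      scalar (Fin (d + 1)) z⁻¹ - P.map (fun x : ℝ => (x : ℂ)) := by
    ext i j
    by_cases hij : i = j
    · subst hij; simp [hA, Matrix.scalar_apply]
    · simp [hA, Matrix.scalar_apply, Matrix.diagonal_apply_ne _ hij, Matrix.one_apply_ne hij]
  -- `L` is row `0` of `(1 - zP)⁻¹`. Written at `z⁻¹ - 1` for `P - 1`, the identity fits the
  -- factorization known for generators.
  have hvec : L ᵥ* (scalar (Fin (d + 1)) (z⁻¹ - 1) - A) = Pi.single 0 z⁻¹ := by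
    rw [hB, Matrix.vecMul_sub]
    ext x
    have h1 : (L ᵥ* scalar (Fin (d + 1)) z⁻¹) x = L x * z⁻¹ := by
      simp [Matrix.scalar_apply, Matrix.vecMul_diagonal]
    have h2 : (L ᵥ* P.map (fun x : ℝ => (x : ℂ))) x =
        ∑' n : ℕ, z ^ n * ((P ^ (n + 1)) 0 x : ℂ) := by
      simp only [Matrix.vecMul, dotProduct, Matrix.map_apply, hL]
      simp_rw [← tsum_mul_right]
      rw [← Summable.tsum_finsetSum fun y _ => (hsum y).mul_right _]
      refine tsum_congr fun n => ?_
      rw [pow_succ, Matrix.mul_apply]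
      push_cast
      rw [Finset.mul_sum]
      exact Finset.sum_congr rfl fun y _ => by ring
    have h3 : L x = (if (0 : Fin (d + 1)) = x then 1 else 0) +
        z * ∑' n : ℕ, z ^ n * ((P ^ (n + 1)) 0 x : ℂ) := by
      simp only [hL]
      rw [(hsum x).tsum_eq_zero_add, ← tsum_mul_left]
      congr 1
      · split_ifs with h <;> simp [h]
      · exact tsum_congr fun n => by ring
    rw [Pi.sub_apply, h1, h2, h3, Pi.single_apply]
    by_cases hx : (0 : Fin (d + 1)) = x
    · simp [hx.symm]; field_simp; ring
    · simp [hx, Ne.symm hx]; field_simp; ring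
  have hskipA : ∀ i j : Fin (d + 1), (i : ℕ) + 1 < (j : ℕ) → A i j = 0 := by
    intro i j hij
    rw [hne i j (fun h => by subst h; omega), hskip i j hij]; simp
  have h := corner_of_vecMul_eq A hskipA (z⁻¹ - 1) z⁻¹ L hvec
  rw [h]
  congr 1
  exact Finset.prod_congr rfl fun i _ => hne _ _ fun h => by
    have := congrArg Fin.val h; simp at this

end Discrete

/-! ### Laplace transforms and the resolvent of the generator. -/

section Continuous

variable {Ω : Type u} {m : MeasurableSpace Ω} {μ : Measure Ω}

/-- Fubini applied to `∫ t ≥ τ, exp (-z t) = exp (-z τ) / z`. -/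
lemma integral_exp_neg_eq_integral [IsProbabilityMeasure μ] {τ : Ω → ℝ} (hτ : Measurable τ)
    (hτ0 : ∀ ω, 0 ≤ τ ω) {z : ℂ} (hz : 0 < z.re) :
    ∫ ω, Complex.exp (-z * (τ ω : ℂ)) ∂μ =
      z * ∫ t in Set.Ioi (0 : ℝ), Complex.exp (-z * (t : ℂ)) * (μ.real {ω | τ ω ≤ t} : ℂ) := by
  have hz0 : z ≠ 0 := fun h => by simp [h] at hz
  have hz' : (-z).re < 0 := by simpa using hz
  set f : ℝ → ℂ := fun t => Complex.exp (-z * (t : ℂ)) with hf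
  have hset : MeasurableSet {x : Ω × ℝ | τ x.1 ≤ x.2} :=
    measurableSet_le (hτ.comp measurable_fst) measurable_snd
  set F : Ω → ℝ → ℂ := fun ω => (Set.Ici (τ ω)).indicator f with hF
  have hFint : Integrable (Function.uncurry F) (μ.prod (volume.restrict (Set.Ici (0 : ℝ)))) := by
    have h1 : Integrable f (volume.restrict (Set.Ici (0 : ℝ))) := by
      have := integrableOn_exp_mul_complex_Ioi hz' 0
      exact (integrableOn_Ici_iff_integrableOn_Ioi).2 this
    have h2 := (h1.comp_snd μ).indicator hset
    refine h2.congr (Filter.Eventually.of_forall fun x => ?_)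
    rfl
  have hswap := integral_integral_swap hFint
  have h1 : ∀ ω, ∫ t in Set.Ici (0 : ℝ), F ω t = f (τ ω) / z := by
    intro ω
    rw [hF, setIntegral_indicator measurableSet_Ici, Set.Ici_inter_Ici, max_eq_right (hτ0 ω),
      integral_Ici_eq_integral_Ioi, hf, integral_exp_mul_complex_Ioi hz', neg_div_neg_eq]
  have h2 : ∀ t, ∫ ω, F ω t ∂μ = f t * (μ.real {ω | τ ω ≤ t} : ℂ) := by
    intro t
    have h3 : (fun ω => F ω t) = {ω | τ ω ≤ t}.indicator fun _ => f t := by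
      ext ω
      simp [hF, Set.indicator_apply]
    have h4 : MeasurableSet {ω | τ ω ≤ t} := hτ measurableSet_Iic
    rw [h3, integral_indicator_const _ h4, Complex.real_smul, mul_comm]
  simp_rw [h1, h2] at hswap
  rw [integral_div, integral_Ici_eq_integral_Ioi] at hswap
  rw [← hswap, mul_div_cancel₀ _ hz0]

open Matrix in
/-- The Laplace transform of the corner entry of the semigroup of a skip-free generator. -/
lemma laplace_corner_mul_det {d : ℕ} {G : Matrix (Fin (d + 1)) (Fin (d + 1)) ℝ}
    (hG : ∀ (t : ℝ≥0) x y, continuousTransition G t x y ∈ Set.Icc (0 : ℝ) 1)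
    (hskip : IsSkipFree G) {z : ℂ} (hz : 0 < z.re) :
    (∫ t in Set.Ioi (0 : ℝ), Complex.exp (-z * (t : ℂ)) *
        ((NormedSpace.exp (t • G) 0 (Fin.last d) : ℝ) : ℂ)) *
      (scalar (Fin (d + 1)) z - G.map (fun x : ℝ => (x : ℂ))).det =
      ∏ i : Fin d, ((G i.castSucc i.succ : ℝ) : ℂ) := by
  set A := G.map (fun x : ℝ => (x : ℂ)) with hA
  have hz' : (-z).re < 0 := by simpa using hz
  have hbd : ∀ t : ℝ, 0 ≤ t → ∀ x y, NormedSpace.exp (t • G) x y ∈ Set.Icc (0 : ℝ) 1 :=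
    fun t ht x y => hG ⟨t, ht⟩ x y
  have hcont : ∀ x y, Continuous fun t : ℝ => NormedSpace.exp (t • G) x y := fun x y =>
    continuous_iff_continuousAt.2 fun t => (hasDerivAt_exp_entry G t x y).continuousAt
  set L : Fin (d + 1) → ℂ := fun x => ∫ t in Set.Ioi (0 : ℝ), Complex.exp (-z * (t : ℂ)) *
    ((NormedSpace.exp (t • G) 0 x : ℝ) : ℂ) with hL
  have hInt : ∀ x, IntegrableOn (fun t : ℝ => Complex.exp (-z * (t : ℂ)) *
      ((NormedSpace.exp (t • G) 0 x : ℝ) : ℂ)) (Set.Ioi 0) := by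
    intro x
    refine (integrableOn_exp_mul_complex_Ioi hz' 0).mul_bdd (c := 1)
      (Complex.continuous_ofReal.comp (hcont 0 x)).aestronglyMeasurable ?_
    filter_upwards [ae_restrict_mem measurableSet_Ioi] with t ht
    have h := hbd t (le_of_lt ht) 0 x
    rw [Complex.norm_real, Real.norm_of_nonneg h.1]
    exact h.2
  have hvec : L ᵥ* (scalar (Fin (d + 1)) z - A) = Pi.single 0 1 := by
    rw [Matrix.vecMul_sub]
    ext x
    have h1 : (L ᵥ* scalar (Fin (d + 1)) z) x = L x * z := by
      simp [Matrix.scalar_apply, Matrix.vecMul_diagonal]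
    have h2 : (L ᵥ* A) x = ∑ y, L y * (G y x : ℂ) := rfl
    -- By the forward equation, integrating this derivative over `(0, ∞)` gives the resolvent
    -- identity; the boundary term at `0` is row `0` of the identity matrix.
    have hder : ∀ t : ℝ, HasDerivAt (fun t : ℝ => Complex.exp (-z * (t : ℂ)) *
        ((NormedSpace.exp (t • G) 0 x : ℝ) : ℂ))
        (-z * (Complex.exp (-z * (t : ℂ)) * ((NormedSpace.exp (t • G) 0 x : ℝ) : ℂ)) +
          ∑ y, (Complex.exp (-z * (t : ℂ)) * ((NormedSpace.exp (t • G) 0 y : ℝ) : ℂ)) *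
            (G y x : ℂ)) t := by
      intro t
      have h3 : HasDerivAt (fun t : ℝ => Complex.exp (-z * (t : ℂ)))
          (Complex.exp (-z * (t : ℂ)) * -z) t := by
        have := ((Complex.ofRealCLM.hasDerivAt (x := t)).const_mul (-z)).cexp
        simpa using this
      have h4 := (hasDerivAt_exp_entry G t 0 x).ofReal_comp
      refine (h3.mul h4).congr_deriv ?_
      push_cast
      rw [Finset.mul_sum]
      congr 1
      · ring
      · exact Finset.sum_congr rfl fun y _ => by ring
    have hlim : Filter.Tendsto (fun t : ℝ => Complex.exp (-z * (t : ℂ)) *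
        ((NormedSpace.exp (t • G) 0 x : ℝ) : ℂ)) Filter.atTop (nhds 0) := by
      have h5 : Filter.Tendsto (fun t : ℝ => Complex.exp (-z * (t : ℂ))) Filter.atTop
          (nhds 0) := by
        simpa [Complex.tendsto_exp_nhds_zero_iff] using
          Filter.Tendsto.const_mul_atTop_of_neg hz' Filter.tendsto_id
      refine squeeze_zero_norm' ?_ (tendsto_zero_iff_norm_tendsto_zero.1 h5)
      filter_upwards [Filter.eventually_ge_atTop 0] with t ht
      have h := hbd t ht 0 x
      rw [norm_mul, Complex.norm_real, Real.norm_of_nonneg h.1]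
      exact mul_le_of_le_one_right (norm_nonneg _) h.2
    have hint2 : ∀ y, IntegrableOn (fun t : ℝ => (Complex.exp (-z * (t : ℂ)) *
        ((NormedSpace.exp (t • G) 0 y : ℝ) : ℂ)) * (G y x : ℂ)) (Set.Ioi 0) := fun y =>
      (hInt y).mul_const _
    have hkey := integral_Ioi_of_hasDerivAt_of_tendsto (a := 0) (m := 0)
      (hder 0).continuousAt.continuousWithinAt (fun t _ => hder t)
      (((hInt x).const_mul (-z)).add (integrable_finsetSum _ fun y _ => hint2 y)) hlim
    rw [integral_add ((hInt x).const_mul (-z)) (integrable_finsetSum _ fun y _ => hint2 y),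
      integral_const_mul, integral_finsetSum _ fun y _ => hint2 y] at hkey
    simp_rw [integral_mul_const] at hkey
    rw [Pi.sub_apply, h1, h2]
    have h6 : (Pi.single 0 1 : Fin (d + 1) → ℂ) x =
        ((NormedSpace.exp ((0 : ℝ) • G) 0 x : ℝ) : ℂ) := by
      rw [zero_smul, NormedSpace.exp_zero, Pi.single_apply, Matrix.one_apply]
      by_cases h7 : x = 0
      · simp [h7]
      · simp [h7, Ne.symm h7]
    rw [h6]
    simp only [Complex.ofReal_zero, mul_zero, Complex.exp_zero, one_mul] at hkey
    linear_combination -hkey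
  have hskipA : ∀ i j : Fin (d + 1), (i : ℕ) + 1 < (j : ℕ) → A i j = 0 := by
    intro i j hij
    simp [hA, hskip i j hij]
  have h := corner_of_vecMul_eq A hskipA z 1 L hvec
  rw [one_mul] at h
  exact h

end Continuous

/-! ### Transforms of convolutions of exponential and geometric laws. -/

section Laws

variable {d : ℕ}

lemma integral_exp_neg_expMeasure {r : ℝ} (hr : 0 < r) {z : ℂ} (hz : 0 ≤ z.re) :
    ∫ x, Complex.exp (-z * (x : ℂ)) ∂(expMeasure r) = (r : ℂ) / (r + z) := by
  have h0 : expMeasure r = volume.withDensity (exponentialPDF r) := rfl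
  have hre : (-(r + z : ℂ)).re < 0 := by simp; linarith
  have hm : Measurable (exponentialPDF r) := (measurable_exponentialPDFReal r).ennreal_ofReal
  rw [h0, integral_withDensity_eq_integral_toReal_smul hm
    (Filter.Eventually.of_forall fun x => ENNReal.ofReal_lt_top)]
  have h1 : (fun x : ℝ => (exponentialPDF r x).toReal • Complex.exp (-z * (x : ℂ))) =
      (Set.Ici (0 : ℝ)).indicator fun x : ℝ => (r : ℂ) * Complex.exp (-(r + z) * (x : ℂ)) := by
    ext x
    by_cases hx : 0 ≤ x
    · rw [Set.indicator_of_mem (Set.mem_Ici.2 hx), exponentialPDF_of_nonneg hx,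
        ENNReal.toReal_ofReal (by positivity), Complex.real_smul]
      push_cast
      rw [mul_assoc, ← Complex.exp_add]
      congr 2
      ring
    · rw [Set.indicator_of_notMem (by simpa using hx), exponentialPDF_of_neg (not_le.1 hx)]
      simp
  rw [h1, integral_indicator measurableSet_Ici, integral_Ici_eq_integral_Ioi, integral_const_mul,
    integral_exp_mul_complex_Ioi hre]
  simp only [Complex.ofReal_zero, mul_zero, Complex.exp_zero]
  rw [neg_div_neg_eq]
  ring

lemma integral_exp_neg_expConvolution {r : Fin d → ℝ} (hr : ∀ j, 0 < r j) {z : ℂ}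
    (hz : 0 ≤ z.re) :
    ∫ x, Complex.exp (-z * (x : ℂ)) ∂(expConvolution r) = ∏ j, (r j : ℂ) / (r j + z) := by
  have := fun j => isProbabilityMeasure_expMeasure (hr j)
  rw [expConvolution, integral_map (by fun_prop) (by fun_prop)]
  have h1 : ∀ x : Fin d → ℝ, Complex.exp (-z * ((∑ j, x j : ℝ) : ℂ)) =
      ∏ j, Complex.exp (-z * (x j : ℂ)) := by
    intro x
    rw [← Complex.exp_sum]
    push_cast
    rw [Finset.mul_sum]
  simp_rw [h1]
  rw [integral_fintype_prod_eq_prod (f := fun _ (x : ℝ) => Complex.exp (-z * (x : ℂ)))]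
  exact Finset.prod_congr rfl fun j _ => integral_exp_neg_expMeasure (hr j) hz

lemma integral_pow_geometricFromOne {p : unitInterval} (hp : p ≠ 0) {z : ℂ} (hz : ‖z‖ ≤ 1) :
    ∫ n, z ^ n ∂(geometricFromOne p) = (p : ℂ) * z / (1 - (1 - p) * z) := by
  have hnorm : ‖(1 - (p : ℂ)) * z‖ < 1 := by
    have h1 : ‖(1 - (p : ℂ))‖ = 1 - p := by
      rw [← Complex.ofReal_one, ← Complex.ofReal_sub, Complex.norm_real,
        Real.norm_of_nonneg (by linarith [p.2.2])]
    have h2 : (0 : ℝ) < p := lt_of_le_of_ne p.2.1 fun h => hp (Subtype.ext h.symm)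
    rw [norm_mul, h1]
    nlinarith [norm_nonneg z, p.2.2]
  rw [geometricFromOne, integral_map (by fun_prop) (by fun_prop), integral_geometricMeasure hp]
  have h3 : ∀ n : ℕ, ((1 - p : ℝ) ^ n * p) • z ^ (n + 1) =
      (p : ℂ) * z * ((1 - (p : ℂ)) * z) ^ n := by
    intro n
    rw [Complex.real_smul, mul_pow]
    push_cast
    ring
  simp_rw [h3]
  rw [tsum_mul_left, tsum_geometric_of_norm_lt_one hnorm, div_eq_mul_inv]

lemma isProbabilityMeasure_geometricFromOne (p : unitInterval) :
    IsProbabilityMeasure (geometricFromOne p) :=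
  Measure.isProbabilityMeasure_map (by fun_prop)

lemma integral_pow_geomConvolution {p : Fin d → unitInterval} (hp : ∀ j, p j ≠ 0) {z : ℂ}
    (hz : ‖z‖ ≤ 1) :
    ∫ n, z ^ n ∂(geomConvolution p) =
      ∏ j, (p j : ℂ) * z / (1 - (1 - p j) * z) := by
  have := fun j => isProbabilityMeasure_geometricFromOne (p j)
  rw [geomConvolution, integral_map (by fun_prop) (by fun_prop)]
  simp_rw [← Finset.prod_pow_eq_pow_sum]
  rw [integral_fintype_prod_eq_prod (f := fun _ (n : ℕ) => z ^ n)]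
  exact Finset.prod_congr rfl fun j _ => integral_pow_geometricFromOne (hp j) hz

/-- Finite measures on `ℕ` with the same generating function on the unit circle are equal. -/
lemma measure_nat_ext_of_integral_pow {μ ν : Measure ℕ} [IsFiniteMeasure μ] [IsFiniteMeasure ν]
    (h : ∀ z : ℂ, ‖z‖ = 1 → ∫ n, z ^ n ∂μ = ∫ n, z ^ n ∂ν) : μ = ν := by
  have hcast : Measurable (fun n : ℕ => (n : ℝ)) := measurable_of_countable _
  have hmap : μ.map (fun n : ℕ => (n : ℝ)) = ν.map (fun n : ℕ => (n : ℝ)) := by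
    apply Measure.ext_of_charFun
    ext t
    rw [charFun_apply_real, charFun_apply_real, integral_map hcast.aemeasurable (by fun_prop),
      integral_map hcast.aemeasurable (by fun_prop)]
    have h1 : ∀ n : ℕ, Complex.exp (t * ((n : ℝ) : ℂ) * Complex.I) =
        Complex.exp (t * Complex.I) ^ n := by
      intro n
      rw [← Complex.exp_nat_mul]
      congr 1
      push_cast
      ring
    simp_rw [h1]
    exact h _ (Complex.norm_exp_ofReal_mul_I t)
  refine Measure.ext_of_singleton fun n => ?_
  have h2 : (fun n : ℕ => (n : ℝ)) ⁻¹' {(n : ℝ)} = {n} := by ext k; simp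
  rw [← h2, ← Measure.map_apply hcast (measurableSet_singleton _), hmap,
    Measure.map_apply hcast (measurableSet_singleton _)]

end Laws

/-! ### Location and multiplicity of the eigenvalues. -/

section Spectrum

variable {d : ℕ}

open Matrix Polynomial

lemma spectrum_of_generator {G : Matrix (Fin (d + 1)) (Fin (d + 1)) ℝ} {π : Fin (d + 1) → ℝ}
    (hG : IsGenerator G) (hirr : IsIrreducible G) (hskip : IsSkipFree G) (hπ : IsProbVec π)
    (hst : π ᵥ* G = 0) {ν : Multiset ℂ} (hν : ν = (eigenvalues (-G)).filter (fun z => z ≠ 0)) :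
    Multiset.card ν = d ∧ (∀ z ∈ ν, 0 < z.re) ∧
      (∀ z : ℂ, (scalar (Fin (d + 1)) z - G.map (fun x : ℝ => (x : ℂ))).det =
        z * (ν.map (z + ·)).prod) ∧
      ν.prod * (π (Fin.last d) : ℂ) = ∏ i : Fin d, ((G i.castSucc i.succ : ℝ) : ℂ) := by
  have hneg : (-G).map (fun x : ℝ => (x : ℂ)) = -G.map (fun x : ℝ => (x : ℂ)) := by
    ext i j; simp
  have h := charpoly_neg_factor (G.map (fun x : ℝ => (x : ℂ))) (fun x => (π x : ℂ))
    (fun i j hij => by simp [hskip i j hij])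
    (fun i => by
      have := hG.row_sum i
      simp only [Matrix.map_apply]
      exact_mod_cast this)
    (fun i => by simpa using (superdiag_pos hirr hskip i).ne')
    (by
      ext j
      have h1 : ∑ x, π x * G x j = 0 := congrFun hst j
      simp only [Matrix.vecMul, dotProduct, Matrix.map_apply, Pi.zero_apply]
      exact_mod_cast h1)
    (by exact_mod_cast hπ.sum_eq_one)
    (by simpa using (stationary_pos hG hirr hπ hst (Fin.last d)).ne')
    ν (by rw [hν, eigenvalues, hneg])
  refine ⟨h.1, fun z hz => ?_, h.2.1, h.2.2⟩
  rw [hν, Multiset.mem_filter] at hz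
  exact re_pos_of_mem_eigenvalues_neg hG hz.1 hz.2

lemma eigenvalues_neg_sub_one (P : Matrix (Fin (d + 1)) (Fin (d + 1)) ℝ) :
    eigenvalues (-(P - 1)) = (eigenvalues P).map fun z => 1 - z := by
  set A := P.map (fun x : ℝ => (x : ℂ)) with hA
  have hmap : (-(P - 1)).map (fun x : ℝ => (x : ℂ)) = 1 - A := by
    ext i j
    by_cases hij : i = j
    · subst hij; simp [hA]
    · simp [hA, Matrix.one_apply_ne hij]
  have hcard : Multiset.card A.charpoly.roots = d + 1 := by
    rw [← (IsAlgClosed.splits A.charpoly).natDegree_eq_card_roots,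
      Matrix.charpoly_natDegree_eq_dim, Fintype.card_fin]
  have hprod : A.charpoly = (A.charpoly.roots.map fun a => X - C a).prod :=
    (IsAlgClosed.splits _).eq_prod_roots_of_monic (Matrix.charpoly_monic A)
  have heval : ∀ z, A.charpoly.eval z = (A.charpoly.roots.map fun a => z - a).prod := by
    intro z
    conv_lhs => rw [hprod, eval_multiset_prod, Multiset.map_map]
    simp
  have hkey : (1 - A).charpoly =
      ((A.charpoly.roots.map fun z => 1 - z).map fun a => X - C a).prod := by
    refine Polynomial.funext fun z => ?_
    rw [Matrix.eval_charpoly, eval_multiset_prod, Multiset.map_map, Multiset.map_map]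
    have h1 : scalar (Fin (d + 1)) z - (1 - A) = -(scalar (Fin (d + 1)) (1 - z) - A) := by
      rw [map_sub, map_one]; abel
    rw [h1, Matrix.det_neg, ← Matrix.eval_charpoly, heval, Fintype.card_fin]
    have h2 : (A.charpoly.roots.map fun a => 1 - z - a) =
        A.charpoly.roots.map fun a => (-1) * (z - (1 - a)) :=
      Multiset.map_congr rfl fun a _ => by ring
    rw [h2, Multiset.prod_map_mul]
    simp only [Multiset.map_const', Multiset.prod_replicate, hcard]
    rw [← mul_assoc, ← mul_pow]
    simp
  rw [eigenvalues, hmap, hkey, roots_multiset_prod_X_sub_C]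
  rfl

/-- A nontrivial eigenvalue of an aperiodic stochastic matrix has modulus less than one. -/
lemma norm_lt_one_of_mem_eigenvalues {P : Matrix (Fin (d + 1)) (Fin (d + 1)) ℝ}
    (hP : P ∈ Matrix.rowStochastic ℝ (Fin (d + 1))) (haper : IsAperiodic P) {z : ℂ}
    (hz : z ∈ eigenvalues P) (hz1 : z ≠ 1) : ‖z‖ < 1 := by
  obtain ⟨v, hv, h⟩ := exists_eigenvector hz
  set A := P.map (fun x : ℝ => (x : ℂ)) with hA
  have hPn : ∀ n, P ^ n ∈ Matrix.rowStochastic ℝ (Fin (d + 1)) := fun n => pow_mem hP n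
  have hpos : ∀ n x y, 0 ≤ (P ^ n) x y := fun n => (Matrix.mem_rowStochastic_iff_sum.1 (hPn n)).1
  have hrow : ∀ n x, ∑ y, (P ^ n) x y = 1 := fun n =>
    (Matrix.mem_rowStochastic_iff_sum.1 (hPn n)).2
  have hpow : ∀ n : ℕ, (A ^ n) *ᵥ v = z ^ n • v := by
    intro n
    induction n with
    | zero => simp
    | succ n ih =>
      rw [pow_succ, ← Matrix.mulVec_mulVec, h, Matrix.mulVec_smul, ih, smul_smul, pow_succ,
        mul_comm]
  have hApow : ∀ n : ℕ, A ^ n = (P ^ n).map (fun x : ℝ => (x : ℂ)) := by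
    intro n
    exact (Matrix.map_pow P Complex.ofRealHom n).symm
  obtain ⟨i, -, hi⟩ := Finset.exists_max_image Finset.univ (fun i => ‖v i‖) ⟨0, Finset.mem_univ 0⟩
  have hvi : 0 < ‖v i‖ := by
    obtain ⟨j, hj⟩ := Function.ne_iff.1 hv
    exact (norm_pos_iff.2 hj).trans_le (hi j (Finset.mem_univ j))
  have heq : ∀ n : ℕ, ∑ j, ((P ^ n) i j : ℂ) * v j = z ^ n * v i := by
    intro n
    have := congrFun (hpow n) i
    rw [hApow] at this
    exact this
  have hle : ‖z‖ ≤ 1 := by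
    have h1 := congrArg norm (heq 1)
    rw [pow_one, pow_one, norm_mul] at h1
    have h2 : ‖∑ j, (P i j : ℂ) * v j‖ ≤ ‖v i‖ := by
      refine (norm_sum_le _ _).trans ?_
      have h3 : ∀ j ∈ Finset.univ, ‖(P i j : ℂ) * v j‖ ≤ P i j * ‖v i‖ := by
        intro j hj
        have := hpos 1 i j
        rw [pow_one] at this
        rw [norm_mul, Complex.norm_real, Real.norm_of_nonneg this]
        exact mul_le_mul_of_nonneg_left (hi j hj) this
      refine (Finset.sum_le_sum h3).trans ?_
      have := hrow 1 i
      rw [pow_one] at this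
      rw [← Finset.sum_mul, this, one_mul]
    rw [h1] at h2
    exact le_of_mul_le_mul_right (by simpa using h2) hvi
  refine lt_of_le_of_ne hle fun hnorm => hz1 ?_
  -- With `‖z‖ = 1` and `i` a coordinate of maximal modulus of `v`, every return time `n` to `i`
  -- satisfies `z ^ n = 1`. So the order of `z` divides all return times, and aperiodicity makes it
  -- `1`.
  rw [← orderOf_eq_one_iff]
  refine haper i _ fun n _ hn => orderOf_dvd_of_pow_eq_one ?_
  -- compare real parts after rotating so that the right-hand side is `‖v i‖ ^ 2`
  set w : ℂ := z ^ n * v i with hw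
  have hwn : ‖w‖ = ‖v i‖ := by rw [hw, norm_mul, norm_pow, hnorm]; simp
  have hre : ∀ j, ((starRingEnd ℂ) w * v j).re ≤ ‖v i‖ ^ 2 := by
    intro j
    refine (Complex.re_le_norm _).trans ?_
    rw [norm_mul, RCLike.norm_conj, hwn, sq]
    exact mul_le_mul_of_nonneg_left (hi j (Finset.mem_univ j)) hvi.le
  -- A weighted average of numbers at most `‖v i‖ ^ 2` attains this bound, so each term of positive
  -- weight does; the term `j = i` has positive weight because `n` is a return time.
  have hsum : ∑ j, (P ^ n) i j * (‖v i‖ ^ 2 - ((starRingEnd ℂ) w * v j).re) = 0 := by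
    have h1 : ((starRingEnd ℂ) w * ∑ j, ((P ^ n) i j : ℂ) * v j).re = ‖v i‖ ^ 2 := by
      rw [heq, ← hw, mul_comm, Complex.mul_conj, Complex.normSq_eq_norm_sq, hwn, Complex.ofReal_re]
    have h2 : ((starRingEnd ℂ) w * ∑ j, ((P ^ n) i j : ℂ) * v j).re =
        ∑ j, (P ^ n) i j * ((starRingEnd ℂ) w * v j).re := by
      rw [Finset.mul_sum, Complex.re_sum]
      refine Finset.sum_congr rfl fun j _ => ?_
      rw [mul_left_comm, Complex.re_ofReal_mul]
    simp_rw [mul_sub]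
    rw [Finset.sum_sub_distrib, ← Finset.sum_mul, hrow, one_mul, ← h2, h1, sub_self]
  have hi0 := (Finset.sum_eq_zero_iff_of_nonneg fun j _ =>
    mul_nonneg (hpos n i j) (sub_nonneg.2 (hre j))).1 hsum i (Finset.mem_univ i)
  have hi1 : ((starRingEnd ℂ) w * v i).re = ‖v i‖ ^ 2 := by
    rcases mul_eq_zero.1 hi0 with h1 | h1
    · exact absurd h1 hn.ne'
    · linarith
  have hwv : w = v i := by
    have h1 : ‖w - v i‖ ^ 2 = 0 := by
      rw [← Complex.normSq_eq_norm_sq, Complex.normSq_sub, Complex.normSq_eq_norm_sq,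
        Complex.normSq_eq_norm_sq, hwn]
      have h2 : (w * (starRingEnd ℂ) (v i)).re = ((starRingEnd ℂ) w * v i).re := by
        simp [Complex.mul_re]
      rw [h2, hi1]
      ring
    exact sub_eq_zero.1 (norm_eq_zero.1 (pow_eq_zero_iff two_ne_zero |>.1 h1))
  have hvi0 : v i ≠ 0 := norm_pos_iff.1 hvi
  exact mul_right_cancel₀ hvi0 (hwv.trans (one_mul _).symm)

lemma isGenerator_sub_one {P : Matrix (Fin (d + 1)) (Fin (d + 1)) ℝ}
    (hP : P ∈ Matrix.rowStochastic ℝ (Fin (d + 1))) : IsGenerator (P - 1) := by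
  have h := Matrix.mem_rowStochastic_iff_sum.1 hP
  refine ⟨fun i j hij => ?_, fun i => ?_⟩
  · simpa [Matrix.one_apply_ne hij] using h.1 i j
  · simp [Finset.sum_sub_distrib, h.2 i, Matrix.one_apply]

lemma isIrreducible_sub_one {P : Matrix (Fin (d + 1)) (Fin (d + 1)) ℝ}
    (hP : IsIrreducible P) : IsIrreducible (P - 1) := by
  intro i j
  induction hP i j with
  | refl => exact Relation.ReflTransGen.refl
  | tail _ hbc ih =>
    rename_i b c _
    by_cases h : b = c
    · exact h ▸ ih
    · exact ih.tail (by simpa [Matrix.one_apply_ne h] using hbc)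

lemma isSkipFree_sub_one {P : Matrix (Fin (d + 1)) (Fin (d + 1)) ℝ}
    (hP : IsSkipFree P) : IsSkipFree (P - 1) := by
  intro i j hij
  have hne : i ≠ j := fun h => by subst h; omega
  simp [Matrix.one_apply_ne hne, hP i j hij]

end Spectrum

/-! ### Transforms of a fastest strong stationary time. -/

section Transforms

variable {d : ℕ} {Ω : Type u} {m : MeasurableSpace Ω} {μ : Measure Ω}

lemma IsStrongStationaryTime.measurable {ι : Type} [LinearOrder ι] [Zero ι] [Add ι]
    [TopologicalSpace ι] [OrderTopology ι] [SecondCountableTopology ι]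
    {p : ι → Matrix (Fin (d + 1)) (Fin (d + 1)) ℝ} {π : Fin (d + 1) → ℝ}
    {X : ι → Ω → Fin (d + 1)} {T : Ω → WithTop ι} (hT : IsStrongStationaryTime p π μ X T) :
    Measurable T := by
  obtain ⟨𝓕, -, hst, -⟩ := hT
  exact hst.measurable'

lemma measureReal_untopA_le {ι : Type} [LinearOrder ι] [Nonempty ι] {T : Ω → WithTop ι}
    (hfin : ∀ᵐ ω ∂μ, T ω ≠ ⊤) (t : ι) :
    μ.real {ω | (T ω).untopA ≤ t} = μ.real {ω | T ω ≤ t} := by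
  apply measureReal_congr
  filter_upwards [hfin] with ω hω
  apply propext
  change (T ω).untopA ≤ t ↔ T ω ≤ t
  obtain ⟨r, hr⟩ := WithTop.ne_top_iff_exists.1 hω
  rw [← hr, WithTop.coe_le_coe]
  rfl

/-- The Laplace transform of a fastest strong stationary time in continuous time. -/
lemma laplace_fastest {G : Matrix (Fin (d + 1)) (Fin (d + 1)) ℝ} {π : Fin (d + 1) → ℝ}
    (hp : IsStationarySemigroup (continuousTransition G) π) (hskip : IsSkipFree G)
    {ν : Multiset ℂ} (hre : ∀ z ∈ ν, 0 < z.re)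
    (hdet : ∀ z : ℂ, (Matrix.scalar (Fin (d + 1)) z - G.map (fun x : ℝ => (x : ℂ))).det =
      z * (ν.map (z + ·)).prod)
    (hprod : ν.prod * (π (Fin.last d) : ℂ) = ∏ i : Fin d, ((G i.castSucc i.succ : ℝ) : ℂ))
    {X : ℝ≥0 → Ω → Fin (d + 1)} {T : Ω → WithTop ℝ≥0}
    (hT : IsFastestStrongStationaryTime (continuousTransition G) π μ X T)
    {z : ℂ} (hz : 0 ≤ z.re) :
    ∫ ω, Complex.exp (-z * (((T ω).untopA : ℝ) : ℂ)) ∂μ = (ν.map fun a => a / (a + z)).prod := by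
  have hTm := hT.1.measurable
  obtain ⟨𝓕, hX, -, hfin, -, -⟩ := hT.1
  have := hX.isProbabilityMeasure
  set τ : Ω → ℝ := fun ω => ((T ω).untopA : ℝ) with hτ
  have hτm : Measurable τ := measurable_coe_nnreal_real.comp hTm.untopA
  have hτ0 : ∀ ω, 0 ≤ τ ω := fun ω => NNReal.coe_nonneg _
  have hπd : (π (Fin.last d) : ℂ) ≠ 0 := by exact_mod_cast (hp.pos (Fin.last d)).ne'
  have hne : ∀ z : ℂ, 0 ≤ z.re → ∀ a ∈ ν, a + z ≠ 0 := by
    intro z hz a ha h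
    have := congrArg Complex.re h
    rw [Complex.add_re, Complex.zero_re] at this
    linarith [hre a ha]
  -- The epochs `t + k` start at the time of interest, and a dense sequence supplies the grids.
  have hcdf : ∀ t : ℝ, 0 < t → μ.real {ω | τ ω ≤ t} =
      NormedSpace.exp (t • G) 0 (Fin.last d) / π (Fin.last d) := by
    intro t ht
    lift t to ℝ≥0 using ht.le
    obtain ⟨q, hq⟩ := TopologicalSpace.exists_dense_seq ℝ≥0
    have h1 := measureReal_fastest_le hp hT (q := q)
      (fun s s' hs => by
        obtain ⟨n, hn⟩ := hq.exists_mem_open isOpen_Ioo (Set.nonempty_Ioo.2 hs)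
        exact ⟨n, hn.1.le, hn.2⟩)
      (s := fun k => t + (k : ℝ≥0))
      (fun j k hjk => by simpa using hjk)
      (fun r => by
        obtain ⟨k, hk⟩ := exists_nat_ge r
        exact ⟨k, hk.trans le_add_self⟩)
    simp only [Nat.cast_zero, add_zero] at h1
    rw [← measureReal_untopA_le hfin] at h1
    exact h1
  have hopen : ∀ z : ℂ, 0 < z.re → ∫ ω, Complex.exp (-z * (τ ω : ℂ)) ∂μ =
      (ν.map fun a => a / (a + z)).prod := by
    intro z hz
    have hz0 : z ≠ 0 := fun h => by simp [h] at hz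
    have hlap := laplace_corner_mul_det
      (fun t x y => ⟨hp.nonneg t x y, hp.le_one t x y⟩) hskip hz
    rw [hdet, ← hprod] at hlap
    rw [integral_exp_neg_eq_integral hτm hτ0 hz]
    have h2 : ∫ t in Set.Ioi (0 : ℝ), Complex.exp (-z * (t : ℂ)) * (μ.real {ω | τ ω ≤ t} : ℂ) =
        (∫ t in Set.Ioi (0 : ℝ), Complex.exp (-z * (t : ℂ)) *
          ((NormedSpace.exp (t • G) 0 (Fin.last d) : ℝ) : ℂ)) / (π (Fin.last d) : ℂ) := by
      rw [← integral_div]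
      refine setIntegral_congr_fun measurableSet_Ioi fun t ht => ?_
      simp only [hcdf t ht]
      push_cast
      ring
    have h3 : (ν.map (z + ·)).prod ≠ 0 := by
      refine Multiset.prod_ne_zero fun h => ?_
      obtain ⟨a, ha, h4⟩ := Multiset.mem_map.1 h
      exact hne z hz.le a ha (by rw [add_comm]; exact h4)
    have h4 : (ν.map fun a => a / (a + z)).prod = ν.prod / (ν.map (z + ·)).prod := by
      rw [Multiset.prod_map_div, Multiset.map_id']
      simp_rw [add_comm z]
    rw [h2, h4, eq_div_iff h3, ← mul_left_inj' hπd, ← hlap]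
    field_simp
  -- Both sides are continuous on the closed half-plane; its boundary carries the characteristic
  -- function.
  have hcl : Set.EqOn (fun z : ℂ => ∫ ω, Complex.exp (-z * (τ ω : ℂ)) ∂μ)
      (fun z => (ν.map fun a => a / (a + z)).prod) {z | 0 ≤ z.re} := by
    refine Set.EqOn.of_subset_closure (s := {z : ℂ | 0 < z.re}) (fun z hz => hopen z hz) ?_ ?_
      (fun z (hz : 0 < z.re) => hz.le) ?_
    · refine continuousOn_of_dominated (bound := fun _ => 1) (fun z _ => ?_) (fun z hz => ?_)
        (integrable_const _) ?_
      · exact (Measurable.aestronglyMeasurable (by fun_prop))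
      · refine Filter.Eventually.of_forall fun ω => ?_
        rw [Complex.norm_exp, Real.exp_le_one_iff]
        have hz : 0 ≤ z.re := hz
        have := mul_nonneg hz (hτ0 ω)
        simpa using this
      · exact Filter.Eventually.of_forall fun ω => by fun_prop
    · refine continuousOn_multiset_prod ν fun a ha => ?_
      exact continuousOn_const.div (continuousOn_const.add continuousOn_id)
        fun z hz => hne z hz a ha
    · rw [Complex.closure_setOfPred_lt_re]
  exact hcl hz

/-- The generating function of a fastest strong stationary time in discrete time. -/
lemma pgf_fastest {P : Matrix (Fin (d + 1)) (Fin (d + 1)) ℝ} {π : Fin (d + 1) → ℝ}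
    (hp : IsStationarySemigroup (discreteTransition P) π) (hskip : IsSkipFree P)
    {θ : Multiset ℂ} (hcard : Multiset.card θ = d) (hθ : ∀ a ∈ θ, ‖a‖ < 1)
    (hdet : ∀ z : ℂ, (Matrix.scalar (Fin (d + 1)) z - (P - 1).map (fun x : ℝ => (x : ℂ))).det =
      z * ((θ.map fun a => 1 - a).map (z + ·)).prod)
    (hprod : (θ.map fun a => 1 - a).prod * (π (Fin.last d) : ℂ) =
      ∏ i : Fin d, (((P - 1) i.castSucc i.succ : ℝ) : ℂ))
    {X : ℕ → Ω → Fin (d + 1)} {T : Ω → WithTop ℕ}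
    (hT : IsFastestStrongStationaryTime (discreteTransition P) π μ X T)
    {z : ℂ} (hz : ‖z‖ ≤ 1) :
    ∫ ω, z ^ (T ω).untopA ∂μ = (θ.map fun a => (1 - a) * z / (1 - a * z)).prod := by
  have hTm := hT.1.measurable
  obtain ⟨𝓕, hX, -, hfin, -, -⟩ := hT.1
  have := hX.isProbabilityMeasure
  set τ : Ω → ℕ := fun ω => (T ω).untopA with hτ
  have hτm : Measurable τ := hTm.untopA
  have hπd : (π (Fin.last d) : ℂ) ≠ 0 := by exact_mod_cast (hp.pos (Fin.last d)).ne'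
  have hne : ∀ z : ℂ, ‖z‖ ≤ 1 → ∀ a ∈ θ, 1 - a * z ≠ 0 := by
    intro z hz a ha h
    have h1 : ‖a * z‖ = 1 := by rw [← sub_eq_zero.1 h]; simp
    rw [norm_mul] at h1
    nlinarith [hθ a ha, norm_nonneg a, norm_nonneg z]
  have hcdf : ∀ n : ℕ, μ.real {ω | τ ω ≤ n} = (P ^ n) 0 (Fin.last d) / π (Fin.last d) := by
    intro n
    have h1 := measureReal_fastest_le hp hT (q := id) (fun s s' hs => ⟨s, le_rfl, hs⟩)
      (s := fun k => n + k) (fun j k hjk => by simpa using hjk)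
      (fun r => ⟨r, Nat.le_add_left _ _⟩)
    simp only [add_zero] at h1
    rw [← measureReal_untopA_le hfin] at h1
    exact h1
  have hsup : ∀ i : Fin d, (P - 1) i.castSucc i.succ = P i.castSucc i.succ := by
    intro i
    have : i.castSucc ≠ i.succ := fun h => by have := congrArg Fin.val h; simp at this
    simp [Matrix.one_apply_ne this]
  simp_rw [hsup] at hprod
  have hopen : ∀ z : ℂ, ‖z‖ < 1 → z ≠ 0 → ∫ ω, z ^ τ ω ∂μ =
      (θ.map fun a => (1 - a) * z / (1 - a * z)).prod := by
    intro z hz hz0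
    have hz1 : 1 - z ≠ 0 := by
      intro h
      rw [← sub_eq_zero.1 h] at hz
      simp at hz
    have hgen := tsum_corner_mul_det (fun n x y => ⟨hp.nonneg n x y, hp.le_one n x y⟩) hskip hz hz0
    rw [hdet, ← hprod, Multiset.map_map] at hgen
    rw [integral_pow_eq_tsum hτm hz]
    have h2 : ∑' n : ℕ, z ^ n * (μ.real {ω | τ ω ≤ n} : ℂ) =
        (∑' n : ℕ, z ^ n * ((P ^ n) 0 (Fin.last d) : ℂ)) / (π (Fin.last d) : ℂ) := by
      rw [← tsum_div_const]
      refine tsum_congr fun n => ?_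
      rw [hcdf n]
      push_cast
      ring
    -- Each factor is `z⁻¹ - 1 + (1 - a) = z⁻¹ * (1 - a * z)`; the `d` factors `z⁻¹` become the
    -- numerators `z` of the geometric transforms.
    have h3 : (θ.map ((z⁻¹ - 1 + ·) ∘ fun a => 1 - a)).prod =
        (z⁻¹) ^ d * (θ.map fun a => 1 - a * z).prod := by
      have h4 : θ.map ((z⁻¹ - 1 + ·) ∘ fun a => 1 - a) = θ.map fun a => z⁻¹ * (1 - a * z) :=
        Multiset.map_congr rfl fun a _ => by simp only [Function.comp]; field_simp; ring
      rw [h4, Multiset.prod_map_mul]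
      simp [hcard]
    have h5 : (θ.map fun a => 1 - a * z).prod ≠ 0 := by
      refine Multiset.prod_ne_zero fun h => ?_
      obtain ⟨a, ha, h4⟩ := Multiset.mem_map.1 h
      exact hne z hz.le a ha h4
    have h6 : (θ.map fun a => (1 - a) * z / (1 - a * z)).prod =
        (θ.map fun a => 1 - a).prod * z ^ d / (θ.map fun a => 1 - a * z).prod := by
      rw [Multiset.prod_map_div, Multiset.prod_map_mul]
      simp [hcard]
    rw [h3] at hgen
    rw [h2, h6, eq_div_iff h5, ← mul_left_inj' hπd]
    set S := ∑' n : ℕ, z ^ n * ((P ^ n) 0 (Fin.last d) : ℂ)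
    set Q := (θ.map fun a => 1 - a * z).prod
    set R := (θ.map fun a => 1 - a).prod
    have h7 : (1 - z) * (S / (π (Fin.last d) : ℂ)) * Q * (π (Fin.last d) : ℂ) =
        (1 - z) * S * Q := by field_simp
    rw [h7]
    have h8 : S * ((1 - z) * Q) = z ^ d * (R * (π (Fin.last d) : ℂ)) := by
      rw [inv_pow] at hgen
      field_simp at hgen
      linear_combination hgen
    linear_combination h8
  -- Continuity adds both the unit circle and the point `0`, excluded so far because of `z⁻¹`.
  have hcl : Set.EqOn (fun z : ℂ => ∫ ω, z ^ τ ω ∂μ)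
      (fun z => (θ.map fun a => (1 - a) * z / (1 - a * z)).prod) (Metric.closedBall 0 1) := by
    refine Set.EqOn.of_subset_closure (s := Metric.ball 0 1 ∩ {0}ᶜ)
      (fun z hz => hopen z (by simpa using hz.1) hz.2) ?_ ?_
      (fun z hz => Metric.ball_subset_closedBall hz.1) ?_
    · refine continuousOn_of_dominated (bound := fun _ => 1) (fun z _ => ?_) (fun z hz => ?_)
        (integrable_const _) ?_
      · exact ((measurable_of_countable fun n : ℕ => z ^ n).comp hτm).aestronglyMeasurable
      · refine Filter.Eventually.of_forall fun ω => ?_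
        rw [norm_pow]
        exact pow_le_one₀ (norm_nonneg _) (by simpa using hz)
      · exact Filter.Eventually.of_forall fun ω => by fun_prop
    · refine continuousOn_multiset_prod θ fun a ha => ?_
      exact (continuousOn_const.mul continuousOn_id).div
        (continuousOn_const.sub (continuousOn_const.mul continuousOn_id))
        fun z hz => hne z (by simpa using hz) a ha
    · rw [← closure_ball (0 : ℂ) one_ne_zero]
      refine closure_minimal ?_ isClosed_closure
      exact (dense_compl_singleton (0 : ℂ)).open_subset_closure_inter Metric.isOpen_ball
  exact hcl (by simpa using hz)

end Transforms

end SkipFree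

theorem theorem3 (d : ℕ) :
    (∀ (G : Matrix (Fin (d + 1)) (Fin (d + 1)) ℝ) (π : Fin (d + 1) → ℝ),
      SkipFree.IsGenerator G → SkipFree.IsIrreducible G → SkipFree.IsSkipFree G →
      SkipFree.IsProbVec π → Matrix.vecMul π G = 0 →
      (∀ t : ℝ≥0, SkipFree.IsStochMonotone
        (SkipFree.continuousTransition (SkipFree.timeReversal π G) t)) →
      ∀ ν : Multiset ℂ, ν = (SkipFree.eigenvalues (-G)).filter (fun z => z ≠ 0) →
        Multiset.card ν = d ∧ (∀ z ∈ ν, 0 < z.re) ∧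
        ∀ (Ω : Type u) (_ : MeasurableSpace Ω) (μ : Measure Ω) (X : ℝ≥0 → Ω → Fin (d + 1))
          (T : Ω → WithTop ℝ≥0),
          SkipFree.IsFastestStrongStationaryTime (SkipFree.continuousTransition G) π μ X T →
            (∀ u : ℂ, 0 ≤ u.re →
              ∫ ω, Complex.exp (-u * (((T ω).untopA : ℝ) : ℂ)) ∂μ =
                (ν.map fun z => z / (z + u)).prod) ∧
            (∀ r : Fin d → ℝ, ν = Finset.univ.val.map (fun j => (r j : ℂ)) →
              μ.map (fun ω => ((T ω).untopA : ℝ)) = SkipFree.expConvolution r)) ∧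
    (∀ (P : Matrix (Fin (d + 1)) (Fin (d + 1)) ℝ) (π : Fin (d + 1) → ℝ),
      P ∈ Matrix.rowStochastic ℝ (Fin (d + 1)) →
      SkipFree.IsIrreducible P → SkipFree.IsAperiodic P → SkipFree.IsSkipFree P →
      SkipFree.IsProbVec π → Matrix.vecMul π P = π →
      SkipFree.IsStochMonotone (SkipFree.timeReversal π P) →
      ∀ θ : Multiset ℂ, θ = (SkipFree.eigenvalues P).filter (fun z => z ≠ 1) →
        Multiset.card θ = d ∧ (∀ z ∈ θ, ‖z‖ < 1) ∧
        ∀ (Ω : Type u) (_ : MeasurableSpace Ω) (μ : Measure Ω) (X : ℕ → Ω → Fin (d + 1))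
          (T : Ω → WithTop ℕ),
          SkipFree.IsFastestStrongStationaryTime (SkipFree.discreteTransition P) π μ X T →
            (∀ u : ℂ, ‖u‖ ≤ 1 →
              ∫ ω, u ^ (T ω).untopA ∂μ = (θ.map fun z => (1 - z) * u / (1 - z * u)).prod) ∧
            (∀ r : Fin d → ℝ, (∀ j, 0 ≤ r j) → θ = Finset.univ.val.map (fun j => (r j : ℂ)) →
              ∃ p : Fin d → unitInterval, (∀ j, (p j : ℝ) = 1 - r j ∧ p j ≠ 0) ∧
                μ.map (fun ω => (T ω).untopA) = SkipFree.geomConvolution p)) := by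
  constructor
  · intro G π hG hirr hskip hπ hst hmono ν hν
    obtain ⟨hcard, hre, hdet, hprod⟩ := SkipFree.spectrum_of_generator hG hirr hskip hπ hst hν
    refine ⟨hcard, hre, fun Ω _ μ X T hT => ?_⟩
    have hp := SkipFree.isStationarySemigroup_continuous hG
      (SkipFree.stationary_pos hG hirr hπ hst) hπ.sum_eq_one hst hmono
    have hlap := fun (z : ℂ) (hz : 0 ≤ z.re) =>
      SkipFree.laplace_fastest hp hskip hre hdet hprod hT hz
    refine ⟨hlap, fun r hr => ?_⟩
    have hr0 : ∀ j, 0 < r j := by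
      intro j
      have := hre (r j : ℂ) (by rw [hr]; exact Multiset.mem_map_of_mem _ (Finset.mem_univ j))
      simpa using this
    have hTm := hT.1.measurable
    obtain ⟨𝓕, hX, -⟩ := hT.1
    have := hX.isProbabilityMeasure
    have hτm : Measurable fun ω => ((T ω).untopA : ℝ) := measurable_coe_nnreal_real.comp hTm.untopA
    have := fun j => isProbabilityMeasure_expMeasure (hr0 j)
    have : IsProbabilityMeasure (SkipFree.expConvolution r) :=
      Measure.isProbabilityMeasure_map (by fun_prop)
    have : IsProbabilityMeasure (μ.map fun ω => ((T ω).untopA : ℝ)) :=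
      Measure.isProbabilityMeasure_map hτm.aemeasurable
    apply Measure.ext_of_charFun
    ext t
    rw [charFun_apply_real, charFun_apply_real]
    have h1 : ∀ x : ℝ, Complex.exp (t * x * Complex.I) =
        Complex.exp (-(-(t * Complex.I)) * (x : ℂ)) := fun x => by congr 1; ring
    simp_rw [h1]
    -- The characteristic function at `t` is the Laplace transform at `-(t * I)`, on the boundary of
    -- the half-plane.
    have hz : 0 ≤ (-(t * Complex.I : ℂ)).re := by simp
    rw [integral_map hτm.aemeasurable (by fun_prop), hlap _ hz,
      SkipFree.integral_exp_neg_expConvolution hr0 hz, hr, Multiset.map_map]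
    rfl
  · intro P π hP hirr haper hskip hπ hst hmono θ hθ
    have hG := SkipFree.isGenerator_sub_one hP
    have hGirr := SkipFree.isIrreducible_sub_one hirr
    have hGst : Matrix.vecMul π (P - 1) = 0 := by
      rw [Matrix.vecMul_sub, hst, Matrix.vecMul_one, sub_self]
    -- The eigenvalues `θ ≠ 1` of `P` correspond to the nonzero eigenvalues `1 - θ` of `-(P - 1)`,
    -- with multiplicity, so the generator results apply.
    have hν : θ.map (fun z => 1 - z) =
        (SkipFree.eigenvalues (-(P - 1))).filter (fun z => z ≠ 0) := by
      rw [SkipFree.eigenvalues_neg_sub_one, Multiset.filter_map, hθ]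
      congr 1
      refine Multiset.filter_congr fun z _ => ?_
      rw [Function.comp_apply, ne_eq, ne_eq, sub_eq_zero, eq_comm]
    obtain ⟨hcard, -, hdet, hprod⟩ := SkipFree.spectrum_of_generator hG hGirr
      (SkipFree.isSkipFree_sub_one hskip) hπ hGst hν
    rw [Multiset.card_map] at hcard
    have hnorm : ∀ z ∈ θ, ‖z‖ < 1 := by
      intro z hz
      rw [hθ, Multiset.mem_filter] at hz
      exact SkipFree.norm_lt_one_of_mem_eigenvalues hP haper hz.1 hz.2
    refine ⟨hcard, hnorm, fun Ω _ μ X T hT => ?_⟩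
    have hp := SkipFree.isStationarySemigroup_discrete hP
      (SkipFree.stationary_pos hG hGirr hπ hGst) hπ.sum_eq_one hst hmono
    have hpgf := fun (z : ℂ) (hz : ‖z‖ ≤ 1) =>
      SkipFree.pgf_fastest hp hskip hcard hnorm hdet hprod hT hz
    refine ⟨hpgf, fun r hr0 hr => ?_⟩
    have hr1 : ∀ j, r j < 1 := by
      intro j
      have := hnorm (r j : ℂ) (by rw [hr]; exact Multiset.mem_map_of_mem _ (Finset.mem_univ j))
      rw [Complex.norm_real, Real.norm_of_nonneg (hr0 j)] at this
      exact this
    set p : Fin d → unitInterval := fun j => ⟨1 - r j, by linarith [hr1 j], by linarith [hr0 j]⟩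
      with hpdef
    have hp0 : ∀ j, p j ≠ 0 := by
      intro j h
      have : 1 - r j = 0 := congrArg Subtype.val h
      linarith [hr1 j]
    refine ⟨p, fun j => ⟨rfl, hp0 j⟩, ?_⟩
    have hτm : Measurable fun ω => (T ω).untopA := hT.1.measurable.untopA
    obtain ⟨𝓕, hX, -⟩ := hT.1
    have := hX.isProbabilityMeasure
    have := fun j => SkipFree.isProbabilityMeasure_geometricFromOne (p j)
    have : IsProbabilityMeasure (SkipFree.geomConvolution p) :=
      Measure.isProbabilityMeasure_map (by fun_prop)
    have : IsProbabilityMeasure (μ.map fun ω => (T ω).untopA) :=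
      Measure.isProbabilityMeasure_map hτm.aemeasurable
    refine SkipFree.measure_nat_ext_of_integral_pow fun z hz => ?_
    rw [integral_map hτm.aemeasurable (by fun_prop), hpgf z hz.le,
      SkipFree.integral_pow_geomConvolution hp0 hz.le, hr, Multiset.map_map]
    refine Finset.prod_congr rfl fun j _ => ?_
    simp [hpdef]
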